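/- Let $\Gamma$ be a finite simplicial graph with vertex set $V(\Gamma)$, $V=|V(\Gamma)|\ge 4$, such that both $\Gamma$ and its complement graph are connected, and let $D=\operatorname{diam}(\Gamma)$. Let $A(\Gamma)=\langle v\in V(\Gamma)\mid vw=wv \text{ for each edge } \{v,w\}\text{ of }\Gamma\rangle$ be the right-angled Artin group on $\Gamma$. The extension graph $\Gamma^e$ has as vertices the elements $v^g=g^{-1}vg$ of $A(\Gamma)$ ($v\in V(\Gamma)$, $g\in A(\Gamma)$), two distinct vertices being adjacent if and only if they commute in $A(\Gamma)$; $d$ is the graph metric on $V(\Gamma^e)$, and $A(\Gamma)$ acts on $V(\Gamma^e)$ isometrically from the right by conjugation, $(x,g)\mapsto x^g=g^{-1}xg$. For $x,y\in V(\Gamma^e)$ and $r>0$ let $$\xi(x,y;r)=\{g\in A(\Gamma): d(x^g,x)\le r \text{ and } d(y^g,y)\le r\}$$ be the $r$-quasi-stabilizer of $(x,y)$. An element $g\in A(\Gamma)$ is called loxodromic if its asymptotic translation length $\lim_{m\to\infty} d(x^{g^m},x)/m$ (which does not depend on $x\in V(\Gamma^e)$) is positive. Then the action of $A(\Gamma)$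 on $\Gamma^e$ is $(R,N)$-acylindrical with $$R=R(r)=D(2V+7)(r+1)+10D,\qquad N=N(r)=\max\{1,\ 2(V-2)r-1\},$$ that is, for every real $r>0$ and all $x,y\in V(\Gamma^e)$ with $d(x,y)\ge R(r)$, the set $\xi(x,y;r)$ is finite with at most $N(r)$ elements. (For $r\ge 1/(V-2)$ one has $N(r)=2(V-2)r-1$.) Moreover, for every real $r>0$ and all $x,y\in V(\Gamma^e)$ with $d(x,y)\ge R(r)$, if $\xi(x,y;r)\ne\{1\}$, then there exists a loxodromic element $g\in A(\Gamma)$ such that 1. $\xi(x,y;r)\subset\{1,g^{\pm1},g^{\pm2},\ldots,g^{\pm k}\}$ for some integer $k$ with $1\le k\le (V-2)r-1$; 2. the Hausdorff distance between the $\langle g\rangle$-orbit of $x$ and the $\langle g\rangle$-orbit of $y$ is at most $D(2r+7)$. -/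

import Mathlib

open scoped RightActions commutatorElement

/-! ### Right isometric actions

A right action of a group `G` on `X` is a `MulAction` of the opposite group `Gᵐᵒᵖ`;
`x <• g` is the image of the point `x` under `g`. -/

section RightAction

variable {G X : Type*} [Group G] [PseudoMetricSpace X] [MulAction Gᵐᵒᵖ X]

/-- The `r`-quasi-stabilizer of the pair of points `(x, y)`. -/
def quasiStabilizer (x y : X) (r : ℝ) : Set G :=
  {g | dist (x <• g) x ≤ r ∧ dist (y <• g) y ≤ r}

variable (G X) in
/-- The isometric right action of `G` on `X` is `(R, N)`-acylindrical: for every `r > 0` the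
constants `R r` and `N r` are positive, and any two points at distance at least `R r` have an
`r`-quasi-stabilizer of cardinality at most `N r`. -/
def IsAcylindricalWith [IsIsometricSMul Gᵐᵒᵖ X] (R N : ℝ → ℝ) : Prop :=
  ∀ r : ℝ, 0 < r → 0 < R r ∧ 0 < N r ∧
    ∀ x y : X, R r ≤ dist x y →
      (quasiStabilizer x y r : Set G).Finite ∧
        ((quasiStabilizer x y r : Set G).ncard : ℝ) ≤ N r

variable (X) in
/-- The asymptotic translation length of `g` on `X` exists and equals `τ`, for every choice of
the base point. -/
def HasTranslationLength (g : G) (τ : ℝ) : Prop :=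
  ∀ x : X, Filter.Tendsto (fun n : ℕ => dist (x <• g ^ n) x / n) Filter.atTop (nhds τ)

variable (X) in
/-- `g` is loxodromic on `X`: its asymptotic translation length is positive. -/
def IsLoxodromic (g : G) : Prop :=
  ∃ τ : ℝ, 0 < τ ∧ HasTranslationLength X g τ

end RightAction

/-- The orbit of `x` under the cyclic group generated by `g`. -/
def cyclicOrbit {G X : Type*} [Group G] [MulAction Gᵐᵒᵖ X] (g : G) (x : X) : Set X :=
  Set.range fun m : ℤ => x <• g ^ m

/-! ### Right-angled Artin groups and extension graphs -/

section Raag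

variable {V : Type*}

/-- The right-angled Artin group `A(Γ)`: generated by the vertices of `Γ`, with the relations
that adjacent vertices commute. -/
abbrev Raag (Γ : SimpleGraph V) : Type _ :=
  PresentedGroup {c : FreeGroup V | ∃ v w, Γ.Adj v w ∧ c = ⁅FreeGroup.of v, FreeGroup.of w⁆}

/-- The vertex `v`, as an element of `A(Γ)`. -/
def Raag.gen (Γ : SimpleGraph V) (v : V) : Raag Γ :=
  PresentedGroup.of v

theorem Raag.commute_gen {Γ : SimpleGraph V} {v w : V} (h : Γ.Adj v w) :
    Commute (Raag.gen Γ v) (Raag.gen Γ w) := by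
  rw [← commutatorElement_eq_one_iff_commute]
  exact PresentedGroup.one_of_mem
    (rels := {c : FreeGroup V | ∃ v w, Γ.Adj v w ∧ c = ⁅FreeGroup.of v, FreeGroup.of w⁆})
    ⟨v, w, h, rfl⟩

theorem Raag.gen_injective (Γ : SimpleGraph V) : Function.Injective (Raag.gen Γ) := by
  classical
  intro v w h
  let f : Raag Γ →* Multiplicative (V →₀ ℤ) :=
    PresentedGroup.toGroup (f := fun u => Multiplicative.ofAdd (Finsupp.single u 1)) (by
      rintro _ ⟨a, b, -, rfl⟩
      rw [map_commutatorElement, commutatorElement_eq_one_iff_commute]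
      exact Commute.all _ _)
  have hf : ∀ u, f (Raag.gen Γ u) = Multiplicative.ofAdd (Finsupp.single u 1) :=
    fun u => PresentedGroup.toGroup.of _
  have h' := congrArg f h
  rw [hf, hf] at h'
  exact Finsupp.single_left_injective one_ne_zero (Multiplicative.ofAdd.injective h')

/-- The vertices of the extension graph: the elements of `A(Γ)` conjugate to a vertex of `Γ`. -/
def ExtensionVertex (Γ : SimpleGraph V) : Type _ :=
  {a : Raag Γ // ∃ (v : V) (g : Raag Γ), a = g⁻¹ * Raag.gen Γ v * g}

/-- The vertex `v ^ g = g⁻¹ v g` of the extension graph. -/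
def ExtensionVertex.mk {Γ : SimpleGraph V} (v : V) (g : Raag Γ) : ExtensionVertex Γ :=
  ⟨g⁻¹ * Raag.gen Γ v * g, v, g, rfl⟩

/-- The extension graph of `Γ`: distinct vertices are adjacent when they commute in `A(Γ)`. -/
def extensionGraph (Γ : SimpleGraph V) : SimpleGraph (ExtensionVertex Γ) where
  Adj a b := a ≠ b ∧ Commute a.1 b.1
  symm := ⟨fun _ _ h => ⟨h.1.symm, h.2.symm⟩⟩
  loopless := ⟨fun _ h => h.1 rfl⟩

/-- `A(Γ)` acts on the vertices of the extension graph from the right by conjugation,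
`a ↦ g⁻¹ a g`. -/
instance (Γ : SimpleGraph V) : MulAction (Raag Γ)ᵐᵒᵖ (ExtensionVertex Γ) where
  smul g a := ⟨g.unop⁻¹ * a.1 * g.unop, by
    obtain ⟨v, h, e⟩ := a.2
    exact ⟨v, h * g.unop, by rw [e]; group⟩⟩
  one_smul a := Subtype.ext (show (1 : Raag Γ)⁻¹ * a.1 * 1 = a.1 by group)
  mul_smul g h a := Subtype.ext
    (show (h.unop * g.unop)⁻¹ * a.1 * (h.unop * g.unop) =
      g.unop⁻¹ * (h.unop⁻¹ * a.1 * h.unop) * g.unop by group)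

theorem extensionGraph_adj_smul {Γ : SimpleGraph V} (g : (Raag Γ)ᵐᵒᵖ) {a b : ExtensionVertex Γ}
    (h : (extensionGraph Γ).Adj a b) : (extensionGraph Γ).Adj (g • a) (g • b) := by
  refine ⟨fun e => h.1 (MulAction.injective g e), ?_⟩
  have := h.2.eq
  change (g.unop⁻¹ * a.1 * g.unop) * (g.unop⁻¹ * b.1 * g.unop) =
    (g.unop⁻¹ * b.1 * g.unop) * (g.unop⁻¹ * a.1 * g.unop)
  calc _ = g.unop⁻¹ * (a.1 * b.1) * g.unop := by group
    _ = g.unop⁻¹ * (b.1 * a.1) * g.unop := by rw [this]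
    _ = _ := by group

theorem extensionGraph_adj_mk {Γ : SimpleGraph V} (g : Raag Γ) {v w : V} (h : Γ.Adj v w) :
    (extensionGraph Γ).Adj (ExtensionVertex.mk v g) (ExtensionVertex.mk w g) := by
  have h1 : (extensionGraph Γ).Adj (ExtensionVertex.mk v 1) (ExtensionVertex.mk w 1) := by
    refine ⟨fun e => h.ne (Raag.gen_injective Γ ?_), ?_⟩
    · simpa [ExtensionVertex.mk] using congrArg Subtype.val e
    · simpa [ExtensionVertex.mk] using Raag.commute_gen h
  have key : ∀ u : V, ExtensionVertex.mk u g = MulOpposite.op g • ExtensionVertex.mk u 1 :=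
    fun u => Subtype.ext (show g⁻¹ * Raag.gen Γ u * g =
      g⁻¹ * ((1 : Raag Γ)⁻¹ * Raag.gen Γ u * 1) * g by group)
  rw [key, key]
  exact extensionGraph_adj_smul _ h1

theorem extensionGraph_connected {Γ : SimpleGraph V} (hΓ : Γ.Connected) :
    (extensionGraph Γ).Connected := by
  have h1 : ∀ (g : Raag Γ) (v w : V),
      (extensionGraph Γ).Reachable (ExtensionVertex.mk v g) (ExtensionVertex.mk w g) := by
    intro g v w
    obtain ⟨p⟩ := hΓ.preconnected v w
    induction p with
    | nil => exact .refl _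
    | cons h _ ih => exact (extensionGraph_adj_mk g h).reachable.trans ih
  have h2 : ∀ (g : Raag Γ) (u : V), ExtensionVertex.mk u (Raag.gen Γ u * g) =
      ExtensionVertex.mk u g := fun g u => Subtype.ext
    (show (Raag.gen Γ u * g)⁻¹ * Raag.gen Γ u * (Raag.gen Γ u * g) =
      g⁻¹ * Raag.gen Γ u * g by group)
  have h3 : ∀ (g h : Raag Γ) (v : V),
      (extensionGraph Γ).Reachable (ExtensionVertex.mk v (h * g)) (ExtensionVertex.mk v g) := by
    intro g h
    have hmem : h ∈ Subgroup.closure (Set.range (Raag.gen Γ)) := by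
      have : Subgroup.closure (Set.range (Raag.gen Γ)) = ⊤ := PresentedGroup.closure_range_of _
      rw [this]; trivial
    induction hmem using Subgroup.closure_induction generalizing g with
    | mem x hx =>
      obtain ⟨u, rfl⟩ := hx
      intro v
      refine (h1 _ v u).trans ?_
      rw [h2]
      exact h1 _ u v
    | one => intro v; rw [one_mul]
    | mul x y _ _ hx hy =>
      intro v
      rw [mul_assoc]
      exact (hx _ v).trans (hy _ v)
    | inv x _ hx =>
      intro v
      have := hx (x⁻¹ * g) v
      rw [mul_inv_cancel_left] at this
      exact this.symm
  have hne : Nonempty (ExtensionVertex Γ) := hΓ.nonempty.map fun v => ExtensionVertex.mk v 1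
  refine ⟨?_⟩
  rintro ⟨_, v, g, rfl⟩ ⟨_, w, h, rfl⟩
  have h4 := h3 h (g * h⁻¹) v
  rw [inv_mul_cancel_right] at h4
  exact h4.trans (h1 h v w)

/-- The graph metric on the vertex set of the extension graph of a connected graph. -/
noncomputable instance (Γ : SimpleGraph V) [hΓ : Fact Γ.Connected] :
    MetricSpace (ExtensionVertex Γ) where
  dist a b := (extensionGraph Γ).dist a b
  dist_self a := by simp
  dist_comm a b := by rw [SimpleGraph.dist_comm]
  dist_triangle a b c := by
    exact_mod_cast (extensionGraph_connected hΓ.out).dist_triangle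
  eq_of_dist_eq_zero {a b} h :=
    (extensionGraph_connected hΓ.out).dist_eq_zero_iff.1 (by exact_mod_cast h)

theorem extensionGraph_dist_smul_le {Γ : SimpleGraph V} (hΓ : Γ.Connected) (g : (Raag Γ)ᵐᵒᵖ)
    (a b : ExtensionVertex Γ) :
    (extensionGraph Γ).dist (g • a) (g • b) ≤ (extensionGraph Γ).dist a b := by
  obtain ⟨p, hp⟩ := (extensionGraph_connected hΓ).exists_walk_length_eq_dist a b
  let f : extensionGraph Γ →g extensionGraph Γ := ⟨fun a => g • a, extensionGraph_adj_smul g⟩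
  rw [← hp, ← SimpleGraph.Walk.length_map f p]
  exact SimpleGraph.dist_le _

instance (Γ : SimpleGraph V) [hΓ : Fact Γ.Connected] :
    IsIsometricSMul (Raag Γ)ᵐᵒᵖ (ExtensionVertex Γ) where
  isometry_smul g := Isometry.of_dist_eq fun a b => by
    refine congrArg (Nat.cast : ℕ → ℝ) (le_antisymm (extensionGraph_dist_smul_le hΓ.out g a b) ?_)
    have := extensionGraph_dist_smul_le hΓ.out g⁻¹ (g • a) (g • b)
    rwa [inv_smul_smul, inv_smul_smul] at this

end Raag

/-! The proof works in the Cayley graph of `A(Γ)` with the left action. Its edges of label `v` are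
dual to walls: two such edges, starting at `g` and `g'`, are dual to the same wall exactly when `g`
and `g'` lie in the same left coset of the link subgroup of `v`. A vertex `g v g⁻¹` of the extension
graph amounts to `v` and the coset of `g` modulo the star subgroup, so every wall has a vertex, and
a path in the extension graph is a chain of star cosets, consecutive ones meeting. A wall that
separates two points must cross one of the cosets of such a chain, so its vertex is within 1 of the
path (`ed_le_of_separates`). Walls with non-adjacent labels never cross (`noncrossing`).

Let `x` and `y` be far apart. The half-spaces separating all translates of one base point from all
translates of the other, under every element moving `x` and `y` by at most four times the allowed
amount, form a window; it contains two walls at distance at least 3 (`farPair_window`). A half-space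
of the window and its translate by a quasi-stabilizing element have the same label and separate the
same two points, so they are nested. A far pair makes the labels of the window connected in the
complement graph, so that fixing one half-space, or moving it strictly inside itself, spreads to the
whole window. An element fixing a half-space of the window is trivial, since otherwise some wall
would cross both members of the far pair (`FarPair.eq_one`). Counting walls of one label then shows
that quasi-stabilizing elements commute (`commute_of_window`), and a Euclidean algorithm on the same
count shows that the centralizer of a translating element is cyclic, with generator `g` say
(`exists_generator`).

For the bounds, each label `t` of the window carries an axis of half-spaces `g ^ k • U t`, and a
group element has a position along each axis. Axes with non-adjacent labels interleave, so their
normalized positions differ by at most 1. The largest position over the labels off the star of `v`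
is a function on the extension graph which `g ^ m` raises by `m` and an edge by at most `|V| - 2`,
never twice in a row with equality. This gives `m < (|V| - 2) d` (`lt_card_mul_ed`), hence both
loxodromicity and the bound on `k`. For the orbits, `y` is slid along the axis of a
quasi-stabilizing element to the position of `x`; if it were still far, a new window would put the
two at different positions (`exists_zpow_ed_le`). -/

section Loxodromic

/-! ### Translation lengths -/

variable {G X : Type*} [Group G] [PseudoMetricSpace X] [MulAction Gᵐᵒᵖ X] [IsIsometricSMul Gᵐᵒᵖ X]

theorem dist_smul_pow_add_le (g : G) (x : X) (m n : ℕ) :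
    dist (x <• g ^ (m + n)) x ≤ dist (x <• g ^ m) x + dist (x <• g ^ n) x := by
  have h : x <• g ^ (m + n) = (x <• g ^ m) <• g ^ n := by
    rw [pow_add, MulOpposite.op_mul, mul_smul]
  rw [h]
  refine (dist_triangle _ (x <• g ^ n) _).trans ?_
  rw [dist_smul]

/-- An element whose displacement of one point grows linearly is loxodromic. -/
theorem isLoxodromic_of_le {g : G} {x₀ : X} {ε : ℝ} (hε : 0 < ε)
    (h : ∀ n : ℕ, ε * n ≤ dist (x₀ <• g ^ n) x₀) : IsLoxodromic X g := by
  -- Fekete's lemma gives the limit at `x₀`. Changing the base point alters the displacement by at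
  -- most `2 * dist x x₀`, which disappears after division by `n`.
  have hsub : Subadditive fun n : ℕ => dist (x₀ <• g ^ n) x₀ := dist_smul_pow_add_le g x₀
  have hlim := hsub.tendsto_lim ⟨0, by
    rintro _ ⟨n, rfl⟩
    exact div_nonneg dist_nonneg n.cast_nonneg⟩
  refine ⟨hsub.lim, lt_of_lt_of_le hε (ge_of_tendsto hlim ?_), fun x => ?_⟩
  · filter_upwards [Filter.eventually_gt_atTop 0] with n hn
    rw [le_div_iff₀ (by exact_mod_cast hn)]
    exact h n
  · have h0 : Filter.Tendsto (fun n : ℕ => 2 * dist x x₀ / n) Filter.atTop (nhds 0) :=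
      tendsto_const_div_atTop_nhds_zero_nat _
    have h1 : Filter.Tendsto (fun n : ℕ => dist (x <• g ^ n) x / n - dist (x₀ <• g ^ n) x₀ / n)
        Filter.atTop (nhds 0) := by
      refine squeeze_zero_norm (fun n => ?_) h0
      rw [← sub_div, Real.norm_eq_abs, abs_div, Nat.abs_cast]
      refine div_le_div_of_nonneg_right ?_ n.cast_nonneg
      have e1 : dist (x <• g ^ n) (x₀ <• g ^ n) = dist x x₀ := dist_smul _ _ _
      have t1 := dist_triangle4 (x <• g ^ n) (x₀ <• g ^ n) x₀ x
      have t2 := dist_triangle4 (x₀ <• g ^ n) (x <• g ^ n) x x₀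
      rw [dist_comm (x₀ <• g ^ n) (x <• g ^ n)] at t2
      rw [dist_comm x₀ x] at t1
      rw [abs_le]
      constructor <;> linarith
    have h2 := h1.add hlim
    rw [zero_add] at h2
    exact h2.congr fun n => by ring

end Loxodromic

/-! ### Standard subgroups -/

namespace Raag

open scoped Pointwise

variable {V : Type*} {Γ : SimpleGraph V}

theorem closure_range_gen (Γ : SimpleGraph V) :
    Subgroup.closure (Set.range (gen Γ)) = ⊤ := PresentedGroup.closure_range_of _

/-- The universal property of `A(Γ)`. -/
theorem exists_hom {H : Type*} [Group H] (f : V → H) (hf : ∀ v w, Γ.Adj v w → Commute (f v) (f w)) :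
    ∃ φ : Raag Γ →* H, ∀ v, φ (gen Γ v) = f v :=
  ⟨PresentedGroup.toGroup (f := f) (by
    rintro _ ⟨a, b, hab, rfl⟩
    rw [map_commutatorElement, commutatorElement_eq_one_iff_commute]
    simpa using hf a b hab), fun _ => PresentedGroup.toGroup.of _⟩

/-- The subgroup generated by a set of vertices. -/
def par (Γ : SimpleGraph V) (S : Set V) : Subgroup (Raag Γ) := Subgroup.closure (gen Γ '' S)

/-- The subgroup generated by the link of a vertex. -/
abbrev lk (Γ : SimpleGraph V) (v : V) : Subgroup (Raag Γ) := par Γ (Γ.neighborSet v)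

/-- The star of a vertex, as a set of vertices. -/
abbrev star (Γ : SimpleGraph V) (v : V) : Set V := insert v (Γ.neighborSet v)

theorem gen_mem_par {S : Set V} {v : V} (h : v ∈ S) : gen Γ v ∈ par Γ S :=
  Subgroup.subset_closure ⟨v, h, rfl⟩

theorem par_mono {S T : Set V} (h : S ⊆ T) : par Γ S ≤ par Γ T :=
  Subgroup.closure_mono (Set.image_mono h)

theorem commute_of_mem_par {S : Set V} {a : Raag Γ} (h : ∀ u ∈ S, Commute a (gen Γ u))
    {z : Raag Γ} (hz : z ∈ par Γ S) : Commute a z := by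
  induction hz using Subgroup.closure_induction with
  | mem x hx => obtain ⟨u, hu, rfl⟩ := hx; exact h u hu
  | one => exact Commute.one_right a
  | mul x y _ _ hx hy => exact hx.mul_right hy
  | inv x _ hx => exact hx.inv_right

theorem commute_of_mem_star {v : V} {z : Raag Γ} (hz : z ∈ par Γ (star Γ v)) :
    Commute (gen Γ v) z :=
  commute_of_mem_par (by
    rintro u (rfl | hu)
    · exact Commute.refl _
    · exact commute_gen hu) hz

/-! ### The crossing parity of a wall -/

section Cocycle

open Classical in
/-- Left multiplication by a generator, together with the parity of the number of crossings of the
wall dual to `v`. -/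
noncomputable def crossStep (Γ : SimpleGraph V) (v u : V) : Equiv.Perm (Raag Γ × Bool) where
  toFun z := (gen Γ u * z.1, xor z.2 (decide (u = v ∧ gen Γ v * z.1 ∈ lk Γ v)))
  invFun z := ((gen Γ u)⁻¹ * z.1, xor z.2 (decide (u = v ∧ z.1 ∈ lk Γ v)))
  left_inv z := by
    rcases z with ⟨x, b⟩
    by_cases h : u = v
    · subst h; simp
    · simp [h]
  right_inv z := by
    rcases z with ⟨x, b⟩
    by_cases h : u = v
    · subst h; simp
    · simp [h]

/-- Only the case where one label is `v` matters. The other label then lies in the link of `v`,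
commutes with `v`, and does not affect the condition that triggers the flip. -/
theorem crossStep_commute (v : V) {a b : V} (hab : Γ.Adj a b) :
    Commute (crossStep Γ v a) (crossStep Γ v b) := by
  have key : ∀ {a b : V}, Γ.Adj a b → ∀ x : Raag Γ, a = v →
      (gen Γ v * (gen Γ b * x) ∈ lk Γ v ↔ gen Γ v * x ∈ lk Γ v) := by
    intro a b hab x hav
    subst hav
    rw [← mul_assoc, (commute_gen hab).eq, mul_assoc]
    exact Subgroup.mul_mem_cancel_left _ (gen_mem_par hab)
  refine Equiv.ext fun ⟨x, c⟩ => ?_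
  refine Prod.ext ?_ ?_
  · change gen Γ a * (gen Γ b * x) = gen Γ b * (gen Γ a * x)
    rw [← mul_assoc, (commute_gen hab).eq, mul_assoc]
  · simp only [crossStep, Equiv.Perm.mul_apply, Equiv.coe_fn_mk]
    by_cases ha : a = v
    · have hb : b ≠ v := fun hb => hab.ne (ha.trans hb.symm)
      simp [ha, hb, key hab x ha]
    · by_cases hb : b = v
      · simp [ha, hb, key hab.symm x hb]
      · simp [ha, hb]

/-- The action of `A(Γ)` recording the parity of crossings of the wall dual to `v`. -/
noncomputable def crossHom (Γ : SimpleGraph V) (v : V) : Raag Γ →* Equiv.Perm (Raag Γ × Bool) :=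
  (exists_hom (crossStep Γ v) fun _ _ => crossStep_commute v).choose

theorem crossHom_gen (v u : V) : crossHom Γ v (gen Γ u) = crossStep Γ v u :=
  (exists_hom (crossStep Γ v) fun _ _ => crossStep_commute v).choose_spec u

theorem crossHom_fst (v : V) (x : Raag Γ) : ∀ z, (crossHom Γ v x z).1 = x * z.1 := by
  have hx : x ∈ Subgroup.closure (Set.range (gen Γ)) := by rw [closure_range_gen]; trivial
  induction hx using Subgroup.closure_induction with
  | mem x hx => obtain ⟨u, rfl⟩ := hx; intro z; rw [crossHom_gen]; rfl
  | one => intro z; simp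
  | mul x y _ _ hx hy => intro z; rw [map_mul, Equiv.Perm.mul_apply, hx, hy, mul_assoc]
  | inv x _ hx =>
    intro z
    have := hx ((crossHom Γ v x)⁻¹ z)
    rw [← Equiv.Perm.mul_apply, mul_inv_cancel, Equiv.Perm.one_apply] at this
    rw [map_inv, this, inv_mul_cancel_left]

/-- The flip condition is membership in the link subgroup, which right multiplication by that
subgroup preserves. This is what makes half-spaces depend on the wall only. -/
theorem crossHom_mul_right (v : V) {l : Raag Γ} (hl : l ∈ lk Γ v) (x : Raag Γ) :
    ∀ z, crossHom Γ v x (z.1 * l, z.2) = ((crossHom Γ v x z).1 * l, (crossHom Γ v x z).2) := by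
  have hx : x ∈ Subgroup.closure (Set.range (gen Γ)) := by rw [closure_range_gen]; trivial
  induction hx using Subgroup.closure_induction with
  | mem x hx =>
    obtain ⟨u, rfl⟩ := hx; rintro ⟨y, b⟩; rw [crossHom_gen]
    have : gen Γ v * (y * l) ∈ lk Γ v ↔ gen Γ v * y ∈ lk Γ v := by
      rw [← mul_assoc]; exact Subgroup.mul_mem_cancel_right _ hl
    simp [crossStep, this, mul_assoc]
  | one => intro z; simp
  | mul x y _ _ hx hy =>
    intro z; rw [map_mul, Equiv.Perm.mul_apply, hy, hx, Equiv.Perm.mul_apply]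
  | inv x _ hx =>
    intro z
    have := hx ((crossHom Γ v x)⁻¹ z)
    rw [← Equiv.Perm.mul_apply, mul_inv_cancel, Equiv.Perm.one_apply] at this
    rw [map_inv, Equiv.Perm.inv_eq_iff_eq, this]

/-- The parity of crossings of the wall dual to `v`, from the base point. -/
noncomputable def parity (v : V) (x : Raag Γ) : Bool := (crossHom Γ v x (1, false)).2

theorem parity_one (v : V) : parity v (1 : Raag Γ) = false := by simp [parity]

theorem parity_gen_mul (v u : V) (x : Raag Γ) :
    parity v (gen Γ u * x) = parity v x ↔ ¬ (u = v ∧ gen Γ v * x ∈ lk Γ v) := by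
  classical
  have h1 := crossHom_fst v x (1, false)
  have h2 : parity v (gen Γ u * x) =
      xor (parity v x) (decide (u = v ∧ gen Γ v * x ∈ lk Γ v)) := by
    unfold parity
    rw [map_mul, Equiv.Perm.mul_apply, crossHom_gen]
    change xor _ (decide (_ ∧ gen Γ v * (crossHom Γ v x (1, false)).1 ∈ _)) = _
    rw [h1]; simp
  rw [h2]
  by_cases h : u = v ∧ gen Γ v * x ∈ lk Γ v
  · rw [decide_eq_true h]; simp [h]
  · rw [decide_eq_false h]; simp [h]

theorem not_mem_lk (v : V) : v ∉ Γ.neighborSet v := fun h => h.ne rfl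

theorem parity_eq_false (v : V) {l : Raag Γ} (hl : l ∈ lk Γ v) : parity v l = false := by
  have key : ∀ z : Raag Γ × Bool, (crossHom Γ v l z).2 = z.2 := by
    induction hl using Subgroup.closure_induction with
    | mem x hx =>
      obtain ⟨u, hu, rfl⟩ := hx
      intro z
      have : u ≠ v := fun h => not_mem_lk v (h ▸ hu)
      rw [crossHom_gen]
      simp [crossStep, this]
    | one => intro z; simp
    | mul x y _ _ hx hy => intro z; rw [map_mul, Equiv.Perm.mul_apply, hx, hy]
    | inv x _ hx =>
      intro z
      have := hx ((crossHom Γ v x)⁻¹ z)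
      rw [← Equiv.Perm.mul_apply, mul_inv_cancel, Equiv.Perm.one_apply] at this
      rw [map_inv, this]
  exact key _

theorem parity_mul_right (v : V) {l : Raag Γ} (hl : l ∈ lk Γ v) (x : Raag Γ) :
    parity v (x * l) = parity v x := by
  have h1 : crossHom Γ v l (1, false) = (l, false) :=
    Prod.ext (by rw [crossHom_fst, mul_one]) (parity_eq_false v hl)
  have h2 := crossHom_mul_right v hl x (1, false)
  rw [one_mul] at h2
  unfold parity
  rw [map_mul, Equiv.Perm.mul_apply, h1, h2]

end Cocycle

/-! ### Half-spaces and walls -/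

/-- The half-space of the wall dual to the edge from `g` to `g * v` that contains `g * v`. -/
def hs (v : V) (g : Raag Γ) : Set (Raag Γ) := {x | parity v (x⁻¹ * g) = true}

theorem smul_hs (k : Raag Γ) (v : V) (g : Raag Γ) : k • hs v g = hs v (k * g) := by
  ext x
  rw [Set.mem_smul_set_iff_inv_smul_mem]
  simp [hs, mul_assoc]

theorem hs_congr {v : V} {g g' : Raag Γ} (h : g⁻¹ * g' ∈ lk Γ v) : hs v g = hs v g' := by
  ext x
  have := parity_mul_right v h (x⁻¹ * g)
  rw [show x⁻¹ * g * (g⁻¹ * g') = x⁻¹ * g' by group] at this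
  simp [hs, this]

theorem base_notMem_hs (v : V) (g : Raag Γ) : g ∉ hs v g := by
  simp [hs, parity_one]

theorem mul_gen_mem_hs_iff (v u : V) (g x : Raag Γ) :
    (x * gen Γ u ∈ hs v g ↔ x ∈ hs v g) ↔ ¬ (u = v ∧ x⁻¹ * g ∈ lk Γ v) := by
  have := parity_gen_mul v u ((x * gen Γ u)⁻¹ * g)
  rw [show gen Γ u * ((x * gen Γ u)⁻¹ * g) = x⁻¹ * g by group] at this
  have h2 : (u = v ∧ gen Γ v * ((x * gen Γ u)⁻¹ * g) ∈ lk Γ v) ↔ (u = v ∧ x⁻¹ * g ∈ lk Γ v) := by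
    constructor
    · rintro ⟨rfl, h⟩; exact ⟨rfl, by convert h using 1; group⟩
    · rintro ⟨rfl, h⟩; exact ⟨rfl, by convert h using 1; group⟩
  rw [← h2, ← this]
  change (parity v ((x * gen Γ u)⁻¹ * g) = true ↔ parity v (x⁻¹ * g) = true) ↔ _
  rw [← Bool.eq_iff_iff, eq_comm]

theorem base_mul_gen_mem_hs (v : V) (g : Raag Γ) : g * gen Γ v ∈ hs v g := by
  by_contra h
  refine (mul_gen_mem_hs_iff v v g g).1 (iff_of_false h (base_notMem_hs v g)) ⟨rfl, ?_⟩
  rw [inv_mul_cancel]; exact one_mem _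

/-- `H` is one of the two half-spaces of the wall dual to the edge from `g` to `g * v`. -/
def IsHalf (v : V) (g : Raag Γ) (H : Set (Raag Γ)) : Prop := H = hs v g ∨ H = (hs v g)ᶜ

theorem isHalf_hs (v : V) (g : Raag Γ) : IsHalf v g (hs v g) := Or.inl rfl

theorem IsHalf.compl {v : V} {g : Raag Γ} {H : Set (Raag Γ)} (h : IsHalf v g H) : IsHalf v g Hᶜ := by
  rcases h with rfl | rfl
  · exact Or.inr rfl
  · exact Or.inl (compl_compl _)

theorem IsHalf.congr {v : V} {g g' : Raag Γ} {H : Set (Raag Γ)} (h : IsHalf v g H)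
    (hg : g⁻¹ * g' ∈ lk Γ v) : IsHalf v g' H := by
  unfold IsHalf at *; rwa [← hs_congr hg]

theorem IsHalf.smul {v : V} {g : Raag Γ} {H : Set (Raag Γ)} (h : IsHalf v g H) (k : Raag Γ) :
    IsHalf v (k * g) (k • H) := by
  rcases h with rfl | rfl
  · exact Or.inl (smul_hs _ _ _)
  · exact Or.inr (by rw [Set.smul_set_compl, smul_hs])

/-- `x` and `y` are joined by an edge of label `u` of the Cayley graph. -/
def Nb (u : V) (x y : Raag Γ) : Prop := y = x * gen Γ u ∨ x = y * gen Γ u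

theorem Nb.symm {u : V} {x y : Raag Γ} (h : Nb u x y) : Nb u y x := Or.symm h

theorem Nb.mem_par {u : V} {x y : Raag Γ} (h : Nb u x y) {S : Set V} (hu : u ∈ S) :
    x⁻¹ * y ∈ par Γ S := by
  rcases h with rfl | rfl
  · rw [inv_mul_cancel_left]; exact gen_mem_par hu
  · rw [show (y * gen Γ u)⁻¹ * y = (gen Γ u)⁻¹ by group]; exact inv_mem (gen_mem_par hu)

/-- The edges crossing a wall. -/
theorem IsHalf.eq_of_nb_gen {v u : V} {g x : Raag Γ} {H : Set (Raag Γ)} (h : IsHalf v g H)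
    (hx : ¬ (x * gen Γ u ∈ H ↔ x ∈ H)) : u = v ∧ x⁻¹ * g ∈ lk Γ v := by
  rcases h with rfl | rfl
  · by_contra h; exact hx ((mul_gen_mem_hs_iff v u g x).2 h)
  · by_contra h; exact hx (not_congr ((mul_gen_mem_hs_iff v u g x).2 h))

/-- Every edge crosses exactly one wall. -/
theorem Nb.exists_half {u : V} {x y : Raag Γ} (h : Nb u x y) :
    ∃ (H : Set (Raag Γ)) (b : Raag Γ), (b = x ∨ b = y) ∧ IsHalf u b H ∧ x ∉ H ∧ y ∈ H ∧
      ∀ v g H', IsHalf v g H' → x ∉ H' → y ∈ H' → v = u ∧ g⁻¹ * b ∈ lk Γ v ∧ H' = H := by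
  rcases h with rfl | rfl
  · refine ⟨hs u x, x, Or.inl rfl, Or.inl rfl, base_notMem_hs u x, base_mul_gen_mem_hs u x, ?_⟩
    intro v g H' h1 h2 h3
    obtain ⟨rfl, h4⟩ := h1.eq_of_nb_gen (u := u) (x := x) (fun h => h2 (h.1 h3))
    have h5 : g⁻¹ * x ∈ lk Γ u := by
      rw [show g⁻¹ * x = (x⁻¹ * g)⁻¹ by group]; exact inv_mem h4
    refine ⟨rfl, h5, ?_⟩
    rcases h1.congr h5 with rfl | rfl
    · rfl
    · exact absurd (base_mul_gen_mem_hs u x) h3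
  · refine ⟨(hs u y)ᶜ, y, Or.inr rfl, Or.inr rfl, fun h => h (base_mul_gen_mem_hs u y),
      base_notMem_hs u y, ?_⟩
    intro v g H' h1 h2 h3
    obtain ⟨rfl, h4⟩ := h1.eq_of_nb_gen (u := u) (x := y) (fun h => h2 (h.2 h3))
    have h5 : g⁻¹ * y ∈ lk Γ u := by
      rw [show g⁻¹ * y = (y⁻¹ * g)⁻¹ by group]; exact inv_mem h4
    refine ⟨rfl, h5, ?_⟩
    rcases h1.congr h5 with rfl | rfl
    · exact absurd h3 (base_notMem_hs u y)
    · rfl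

/-- The label and the wall of a half-space are determined by the half-space. -/
theorem IsHalf.unique {v v' : V} {g g' : Raag Γ} {H : Set (Raag Γ)} (h : IsHalf v g H)
    (h' : IsHalf v' g' H) : v' = v ∧ g'⁻¹ * g ∈ lk Γ v := by
  have : ¬ (g * gen Γ v ∈ H ↔ g ∈ H) := by
    rcases h with rfl | rfl
    · exact fun h => base_notMem_hs v g (h.1 (base_mul_gen_mem_hs v g))
    · exact fun h => h.2 (base_notMem_hs v g) (base_mul_gen_mem_hs v g)
  obtain ⟨rfl, h1⟩ := h'.eq_of_nb_gen this
  refine ⟨rfl, ?_⟩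
  rw [show g'⁻¹ * g = (g⁻¹ * g')⁻¹ by group]; exact inv_mem h1

/-- Connectedness of the Cayley graph, as an induction along edges. -/
theorem nb_induction {y : Raag Γ} {P : Raag Γ → Prop} (h0 : P y)
    (h1 : ∀ u x x', Nb u x x' → P x' → P x) (x : Raag Γ) : P x := by
  have key : ∀ z : Raag Γ, ∀ y, P y ↔ P (y * z) := by
    intro z
    have hz : z ∈ Subgroup.closure (Set.range (gen Γ)) := by rw [closure_range_gen]; trivial
    induction hz using Subgroup.closure_induction with
    | mem z hz =>
      obtain ⟨u, rfl⟩ := hz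
      exact fun y => ⟨fun h => h1 u _ _ (Or.inr rfl) h, fun h => h1 u _ _ (Or.inl rfl) h⟩
    | one => intro y; rw [mul_one]
    | mul a b _ _ ha hb => intro y; rw [ha, hb, mul_assoc]
    | inv a _ ha => intro y; rw [ha (y * a⁻¹), inv_mul_cancel_right]
  have := (key (y⁻¹ * x) y).1 h0
  rwa [mul_inv_cancel_left] at this

/-- A wall separating two points of a coset of a standard subgroup is dual to an edge of the
coset. -/
theorem IsHalf.of_par {S : Set V} {u : V} {c : Raag Γ} {H : Set (Raag Γ)} (hH : IsHalf u c H)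
    {z : Raag Γ} (hz : z ∈ par Γ S) : ∀ x, ¬ (x ∈ H ↔ x * z ∈ H) →
      u ∈ S ∧ ∃ b, x⁻¹ * b ∈ par Γ S ∧ c⁻¹ * b ∈ lk Γ u := by
  induction hz using Subgroup.closure_induction with
  | mem z hz =>
    obtain ⟨v, hv, rfl⟩ := hz
    intro x hx
    obtain ⟨rfl, h1⟩ := hH.eq_of_nb_gen (fun h => hx h.symm)
    refine ⟨hv, x, by rw [inv_mul_cancel]; exact one_mem _, ?_⟩
    rw [show c⁻¹ * x = (x⁻¹ * c)⁻¹ by group]; exact inv_mem h1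
  | one => intro x hx; simp at hx
  | mul a b ha hb iha ihb =>
    intro x hx
    by_cases h : x ∈ H ↔ x * a ∈ H
    · obtain ⟨h1, d, h2, h3⟩ := ihb (x * a) (by rw [mul_assoc]; exact fun h' => hx (h.trans h'))
      refine ⟨h1, d, ?_, h3⟩
      rw [show x⁻¹ * d = a * ((x * a)⁻¹ * d) by group]
      exact mul_mem ha h2
    · exact iha x h
  | inv a ha iha =>
    intro x hx
    obtain ⟨h1, d, h2, h3⟩ := iha (x * a⁻¹) (by
      rw [inv_mul_cancel_right]; exact fun h => hx h.symm)
    refine ⟨h1, d, ?_, h3⟩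
    rw [show x⁻¹ * d = a⁻¹ * ((x * a⁻¹)⁻¹ * d) by group]
    exact mul_mem (inv_mem ha) h2

/-- The half-spaces that contain `y` but not `x`. -/
def Sep (x y : Raag Γ) : Set (Set (Raag Γ)) := {H | (∃ v g, IsHalf v g H) ∧ x ∉ H ∧ y ∈ H}

theorem compl_mem_sep {x y : Raag Γ} {H : Set (Raag Γ)} (h : H ∈ Sep x y) : Hᶜ ∈ Sep y x := by
  obtain ⟨⟨v, g, h1⟩, h2, h3⟩ := h
  exact ⟨⟨v, g, h1.compl⟩, fun h => h h3, h2⟩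

theorem smul_mem_sep {x y : Raag Γ} {H : Set (Raag Γ)} (h : H ∈ Sep x y) (k : Raag Γ) :
    k • H ∈ Sep (k * x) (k * y) := by
  obtain ⟨⟨v, g, h1⟩, h2, h3⟩ := h
  refine ⟨⟨v, k * g, h1.smul k⟩, ?_, ?_⟩
  · rwa [Set.mem_smul_set_iff_inv_smul_mem, smul_eq_mul, inv_mul_cancel_left]
  · rwa [Set.mem_smul_set_iff_inv_smul_mem, smul_eq_mul, inv_mul_cancel_left]

/-- Each edge crosses a single wall, so one step adds at most one half-space. -/
theorem finite_sep (x y : Raag Γ) : (Sep x y).Finite := by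
  refine nb_induction (y := y) (P := fun x => (Sep x y).Finite) ?_ ?_ x
  · refine Set.Finite.subset Set.finite_empty ?_
    rintro H ⟨-, h1, h2⟩
    exact absurd h2 h1
  · intro u x x' hx h
    obtain ⟨K, b, -, -, -, -, hK⟩ := hx.exists_half
    refine (h.union (Set.finite_singleton K)).subset ?_
    rintro H ⟨⟨v, g, h1⟩, h2, h3⟩
    by_cases h4 : x' ∈ H
    · exact Or.inr (hK v g H h1 h2 h4).2.2
    · exact Or.inl ⟨⟨v, g, h1⟩, h4, h3⟩

theorem gen_notMem_lk (v : V) : gen Γ v ∉ lk Γ v := fun h => by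
  have h1 := base_mul_gen_mem_hs v (1 : Raag Γ)
  rw [hs_congr (g' := 1 * gen Γ v) (by simpa using h)] at h1
  exact base_notMem_hs _ _ h1

/-! ### Carriers and crossing walls -/

/-- `x` is an endpoint of an edge crossing the wall dual to the edge from `c` to `c * u`. -/
def InCarrier (u : V) (c x : Raag Γ) : Prop :=
  ∃ a, c⁻¹ * a ∈ lk Γ u ∧ (x = a ∨ x = a * gen Γ u)

theorem IsHalf.carrier_of_nb {v w : V} {b x x' : Raag Γ} {W : Set (Raag Γ)} (hW : IsHalf w b W)
    (h : Nb v x x') (hx : ¬ (x ∈ W ↔ x' ∈ W)) :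
    v = w ∧ InCarrier w b x ∧ InCarrier w b x' := by
  rcases h with rfl | rfl
  · obtain ⟨rfl, h1⟩ := hW.eq_of_nb_gen (fun h => hx h.symm)
    have h2 : b⁻¹ * x ∈ lk Γ v := by
      rw [show b⁻¹ * x = (x⁻¹ * b)⁻¹ by group]; exact inv_mem h1
    exact ⟨rfl, ⟨x, h2, Or.inl rfl⟩, ⟨x, h2, Or.inr rfl⟩⟩
  · obtain ⟨rfl, h1⟩ := hW.eq_of_nb_gen hx
    have h2 : b⁻¹ * x' ∈ lk Γ v := by
      rw [show b⁻¹ * x' = (x'⁻¹ * b)⁻¹ by group]; exact inv_mem h1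
    exact ⟨rfl, ⟨x', h2, Or.inr rfl⟩, ⟨x', h2, Or.inl rfl⟩⟩

theorem IsHalf.mem_iff_of_nb {v w : V} {b x x' : Raag Γ} {W : Set (Raag Γ)} (hW : IsHalf w b W)
    (h : Nb v x x') (hvw : v ≠ w) : x ∈ W ↔ x' ∈ W := by
  by_contra hx; exact hvw (hW.carrier_of_nb h hx).1

/-- Two half-spaces separating the endpoints of an edge in the same way are equal. -/
theorem Nb.half_eq {v u w : V} {c b x x' : Raag Γ} {U W : Set (Raag Γ)} (h : Nb v x x')
    (hU : IsHalf u c U) (hW : IsHalf w b W) (h1 : x ∉ U) (h2 : x' ∈ U) (h3 : x ∉ W)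
    (h4 : x' ∈ W) : U = W := by
  obtain ⟨H, b, -, -, -, -, h⟩ := h.exists_half
  rw [(h _ _ U hU h1 h2).2.2, (h _ _ W hW h3 h4).2.2]

/-- A wall disjoint from a carrier has the whole carrier on one side. -/
theorem carrier_side {u w : V} {c b : Raag Γ} {U W : Set (Raag Γ)} (hU : IsHalf u c U)
    (hW : IsHalf w b W) (h0 : ∀ a, c⁻¹ * a ∈ lk Γ u → (a ∈ W ↔ c ∈ W)) (h1 : W ≠ U) (h2 : W ≠ Uᶜ)
    {x : Raag Γ} (hx : InCarrier u c x) : x ∈ W ↔ c ∈ W := by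
  obtain ⟨a, ha, hx | hx⟩ := hx
  · exact hx ▸ h0 a ha
  · rw [← h0 a ha, hx]
    by_contra h
    have hU' := hU.congr ha
    have e : U = hs u a ∨ U = (hs u a)ᶜ := hU'
    have hn : Nb u a (a * gen Γ u) := Or.inl rfl
    by_cases h3 : a ∈ W
    · have := hn.half_eq (isHalf_hs u a) hW.compl (base_notMem_hs u a) (base_mul_gen_mem_hs u a)
        (fun h => h h3) (fun h4 => h (iff_of_true h4 h3))
      rcases e with rfl | rfl
      · exact h2 (by rw [this, compl_compl])
      · exact h1 (by rw [this, compl_compl])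
    · have := hn.half_eq (isHalf_hs u a) hW (base_notMem_hs u a) (base_mul_gen_mem_hs u a)
        h3 (by by_contra h4; exact h (iff_of_false h4 h3))
      rcases e with rfl | rfl
      · exact h1 this.symm
      · exact h2 (by rw [this, compl_compl])

theorem carrier_side_of_not_adj {u w : V} {c b : Raag Γ} {U W : Set (Raag Γ)} (hU : IsHalf u c U)
    (hW : IsHalf w b W) (huw : ¬ Γ.Adj u w) (h1 : W ≠ U) (h2 : W ≠ Uᶜ)
    {x : Raag Γ} (hx : InCarrier u c x) : x ∈ W ↔ c ∈ W :=
  carrier_side hU hW (fun a ha => by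
    by_contra h
    refine huw (hW.of_par ha c fun h' => h ?_).1
    rw [h', mul_inv_cancel_left]) h1 h2 hx

/-- The carrier of `U` lies on the side of `c` with respect to `W`, and the carrier of `W` on the
side of `b` with respect to `U`. A path from `c` enters the far side of `W` through the carrier of
`W`, and while there it cannot cross `U`. -/
theorem side_const {u w : V} {c b : Raag Γ} {U W : Set (Raag Γ)} (hU : IsHalf u c U)
    (hW : IsHalf w b W) (huw : ¬ Γ.Adj u w) (h1 : W ≠ U) (h2 : W ≠ Uᶜ) (x : Raag Γ) :
    ¬ (x ∈ W ↔ c ∈ W) → (x ∈ U ↔ b ∈ U) := by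
  have h3 : U ≠ Wᶜ := fun h => h2 (by rw [h, compl_compl])
  refine nb_induction (y := c) (P := fun x => ¬ (x ∈ W ↔ c ∈ W) → (x ∈ U ↔ b ∈ U))
    (fun h => absurd Iff.rfl h) ?_ x
  intro v x x' hx ih hxW
  by_cases h : x' ∈ W ↔ c ∈ W
  · exact carrier_side_of_not_adj hW hU (fun h => huw h.symm) h1.symm h3
      (hW.carrier_of_nb hx fun h' => hxW (h'.trans h)).2.1
  · rw [← ih h]
    by_contra h5
    exact hxW (carrier_side_of_not_adj hU hW huw h1 h2 (hU.carrier_of_nb hx h5).2.1)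

/-- Walls with labels that are not adjacent do not cross. -/
theorem noncrossing {u w : V} {c b : Raag Γ} {U W : Set (Raag Γ)} (hU : IsHalf u c U)
    (hW : IsHalf w b W) (huw : ¬ Γ.Adj u w) : U ⊆ W ∨ W ⊆ U ∨ U ⊆ Wᶜ ∨ Uᶜ ⊆ W := by
  by_cases h1 : W = U
  · exact Or.inl h1.ge
  by_cases h2 : W = Uᶜ
  · exact Or.inr (Or.inr (Or.inr h2.ge))
  have h := side_const hU hW huw h1 h2
  -- The sides on which the two base points lie decide which of the four quadrants is empty.
  by_cases hc : c ∈ W <;> by_cases hb : b ∈ U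
  · right; right; right
    intro x hx; by_contra h3
    exact hx ((h x (fun h => h3 (h.2 hc))).2 hb)
  · left
    intro x hx; by_contra h3
    exact hb ((h x (fun h => h3 (h.2 hc))).1 hx)
  · right; left
    intro x hx
    exact (h x (fun h => hc (h.1 hx))).2 hb
  · right; right; left
    intro x hx h3
    exact hb ((h x (fun h => hc (h.1 h3))).1 hx)

theorem adj_of_crossing {u w : V} {c b : Raag Γ} {U W : Set (Raag Γ)} (hU : IsHalf u c U)
    (hW : IsHalf w b W) {p q x y : Raag Γ} (hpU : p ∉ U) (hpW : p ∉ W) (hqU : q ∈ U) (hqW : q ∈ W)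
    (hxU : x ∈ U) (hxW : x ∉ W) (hyU : y ∉ U) (hyW : y ∈ W) : Γ.Adj u w := by
  by_contra h
  rcases noncrossing hU hW h with h | h | h | h
  · exact hxW (h hxU)
  · exact hyU (h hyW)
  · exact h hqU hqW
  · exact hpW (h hpU)

theorem Nb.square {v a : V} {x y z : Raag Γ} (h : Γ.Adj v a) (h1 : Nb v x y) (h2 : Nb a x z) :
    ∃ t, Nb v z t ∧ Nb a y t := by
  have e := (commute_gen h).eq
  rcases h1 with h1 | h1 <;> rcases h2 with h2 | h2
  · exact ⟨x * gen Γ v * gen Γ a, Or.inl (by rw [h2, mul_assoc, mul_assoc, e]), Or.inl (by rw [h1])⟩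
  · exact ⟨z * gen Γ v, Or.inl rfl, Or.inr (by rw [h1, h2, mul_assoc, mul_assoc, e])⟩
  · exact ⟨y * gen Γ a, Or.inr (by rw [h2, h1, mul_assoc, mul_assoc, e]), Or.inl rfl⟩
  · refine ⟨y * (gen Γ a)⁻¹, Or.inr ?_, Or.inr (by group)⟩
    rw [mul_assoc, ((commute_gen h).inv_right).eq.symm, ← mul_assoc, ← h1, h2]; group

/-- The base coset of the wall fixes the orientation of its dual edges: `x` and `x * u` are not both
in it, because `u` is not in its own link subgroup. -/
theorem Nb.eq_of_half {v w u : V} {x y z c : Raag Γ} {U : Set (Raag Γ)} (hU : IsHalf u c U)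
    (hy : Nb v x y) (hz : Nb w x z) (h1 : x ∉ U) (h2 : y ∈ U) (h3 : z ∈ U) : y = z := by
  obtain ⟨H, b, hb, -, -, -, h⟩ := hy.exists_half
  obtain ⟨H', b', hb', -, -, -, h'⟩ := hz.exists_half
  obtain ⟨rfl, h4, -⟩ := h _ _ U hU h1 h2
  obtain ⟨rfl, h4', -⟩ := h' _ _ U hU h1 h3
  have hx' : ∀ {x : Raag Γ}, (c⁻¹ * x ∈ lk Γ u) → (c⁻¹ * (x * gen Γ u) ∈ lk Γ u) → False := by
    intro x h1 h2
    rw [← mul_assoc] at h2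
    exact gen_notMem_lk u ((Subgroup.mul_mem_cancel_left _ h1).1 h2)
  have gA : ∀ {x y : Raag Γ}, Nb u x y → x ∉ U → y ∈ U →
      (c⁻¹ * x ∈ lk Γ u ∧ y = x * gen Γ u) ∨ (c⁻¹ * y ∈ lk Γ u ∧ x = y * gen Γ u) := by
    intro x y hn h1 h2
    rcases hn with rfl | rfl
    · left
      have := (hU.eq_of_nb_gen (u := u) (x := x) (fun h => h1 (h.1 h2))).2
      exact ⟨by rw [show c⁻¹ * x = (x⁻¹ * c)⁻¹ by group]; exact inv_mem this, rfl⟩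
    · right
      have := (hU.eq_of_nb_gen (u := u) (x := y) (fun h => h1 (h.2 h2))).2
      exact ⟨by rw [show c⁻¹ * y = (y⁻¹ * c)⁻¹ by group]; exact inv_mem this, rfl⟩
  rcases gA hy h1 h2 with ⟨a1, a2⟩ | ⟨a1, a2⟩ <;> rcases gA hz h1 h3 with ⟨b1, b2⟩ | ⟨b1, b2⟩
  · rw [a2, b2]
  · exact (hx' b1 (b2 ▸ a1)).elim
  · exact (hx' a1 (a2 ▸ b1)).elim
  · exact mul_right_cancel (a2.symm.trans b2)

/-! ### Geodesics -/

/-- There is a path from the given point to `y` along which every crossed wall separates the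
remaining part of the path from the past. -/
inductive Geo (y : Raag Γ) : Raag Γ → Prop
  | refl : Geo y y
  | step {u : V} {x x' : Raag Γ} {H : Set (Raag Γ)} : Nb u x x' → H ∈ Sep x y → x' ∈ H →
      Geo y x' → Geo y x

theorem Geo.cross {y x' : Raag Γ} (h : Geo y x') : ∀ {a u : V} {x c : Raag Γ} {U : Set (Raag Γ)},
    IsHalf u c U → Nb a x' x → x' ∉ U → x ∈ U → y ∈ U → Geo y x := by
  induction h with
  | refl => intro a u x c U _ _ h1 _ h2; exact absurd h2 h1
  | @step v x' x'' K hn hK hx'' hg ih =>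
    intro a u x c U hU ha h1 h2 h3
    obtain ⟨⟨k, d, hK1⟩, hK2, hK3⟩ := hK
    by_cases hKU : K = U
    · subst hKU
      exact hn.eq_of_half hU ha h1 hx'' h2 ▸ hg
    have hxK : x ∉ K := fun h => hKU (ha.half_eq hK1 hU hK2 h h1 h2)
    have hxU : x'' ∉ U := fun h => hKU (hn.half_eq hK1 hU hK2 hx'' h1 h)
    obtain rfl := (hK1.carrier_of_nb hn fun h => hK2 (h.2 hx'')).1
    obtain rfl := (hU.carrier_of_nb ha fun h => h1 (h.2 h2)).1
    have hadj : Γ.Adj v a := adj_of_crossing hK1 hU hK2 h1 hK3 h3 hx'' hxU hxK h2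
    obtain ⟨t, ht1, ht2⟩ := hn.square hadj ha
    have htU : t ∈ U := (hU.mem_iff_of_nb ht1 hadj.ne).1 h2
    have htK : t ∈ K := (hK1.mem_iff_of_nb ht2 hadj.ne').1 hx''
    exact Geo.step ht1 ⟨⟨_, _, hK1⟩, hxK, hK3⟩ htK (ih hU ht2 hxU htU h3)

theorem geo (y x : Raag Γ) : Geo y x := by
  refine nb_induction (y := y) (P := Geo y) Geo.refl ?_ x
  intro u x x' hx h
  obtain ⟨H, b, -, hH, h1, h2, -⟩ := hx.exists_half
  by_cases h3 : y ∈ H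
  · exact Geo.step hx ⟨⟨_, _, hH⟩, h1, h3⟩ h2 h
  · exact h.cross hH.compl hx.symm (fun h => h h2) h1 h3

/-- The walls crossed after one step of a geodesic. -/
theorem Sep.of_step {u : V} {x x' y : Raag Γ} {K H : Set (Raag Γ)} (hn : Nb u x x')
    (hK : K ∈ Sep x y) (hx' : x' ∈ K) (hH : H ∈ Sep x' y) : H ∈ Sep x y ∧ H ≠ K := by
  obtain ⟨⟨v, g, h1⟩, h2, h3⟩ := hH
  obtain ⟨⟨w, k, h4⟩, h5, h6⟩ := hK
  refine ⟨⟨⟨v, g, h1⟩, fun h => ?_, h3⟩, fun h => h2 (h ▸ hx')⟩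
  have := hn.half_eq h4 h1.compl h5 hx' (fun h' => h' h) h2
  rw [this] at h6
  exact h6 h3

theorem eq_of_sep_empty {x y : Raag Γ} (h : ∀ H, H ∉ Sep x y) : x = y := by
  cases geo y x with
  | refl => rfl
  | step _ hH _ _ => exact absurd hH (h _)

/-- A geodesic only uses the labels of the walls that separate its endpoints. -/
theorem mem_par_of_sep {S : Set V} {x y : Raag Γ}
    (h : ∀ v g H, IsHalf v g H → H ∈ Sep x y → v ∈ S) : x⁻¹ * y ∈ par Γ S := by
  have hg := geo y x
  induction hg with
  | refl => rw [inv_mul_cancel]; exact one_mem _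
  | @step u x x' H hn hH hx' _ ih =>
    have h1 := ih fun v g K hK hK' => h v g K hK (Sep.of_step hn hH hx' hK').1
    obtain ⟨⟨v, g, h2⟩, h3, h4⟩ := hH
    obtain ⟨rfl, -⟩ := h2.carrier_of_nb hn fun h => h3 (h.2 hx')
    have h5 := hn.mem_par (h _ _ H h2 ⟨⟨_, _, h2⟩, h3, h4⟩)
    rw [show x⁻¹ * y = (x⁻¹ * x') * (x'⁻¹ * y) by group]
    exact mul_mem h5 h1

theorem Sep.of_step_right {u : V} {x x' y : Raag Γ} {K H : Set (Raag Γ)} (hn : Nb u x x')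
    (hK : K ∈ Sep x y) (hx' : x' ∈ K) (hH : H ∈ Sep y x') : H ∈ Sep y x := by
  have := compl_mem_sep (Sep.of_step hn hK hx' (compl_mem_sep hH)).1
  rwa [compl_compl] at this

/-! ### Gates and bridges -/

/-- A point of a coset of a standard subgroup that is closest to `q` is a gate for `q`. -/
theorem notMem_of_closest {S : Set V} {c q : Raag Γ}
    (hmin : ∀ z ∈ par Γ S, (Sep c q).ncard ≤ (Sep (c * z) q).ncard) {K : Set (Raag Γ)}
    (hK : K ∈ Sep c q) {z : Raag Γ} (hz : z ∈ par Γ S) : c * z ∉ K := by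
  have label : ∀ {H : Set (Raag Γ)} {v : V} {g : Raag Γ}, IsHalf v g H → H ∈ Sep c (c * z) → v ∈ S :=
    fun hH h => (hH.of_par hz c fun h' => h.2.1 (h'.2 h.2.2)).1
  -- An edge with label in `S` that enters `K` is pushed back along the geodesic from `e` to `c`. At
  -- each step either the wall `H` just crossed also separates `c` from `q` and replaces `K`, or `H`
  -- and `K` cross and the edge slides across a square. Once the edge starts at `c`, its other end
  -- is closer to `q`, contradicting minimality.
  have main : ∀ e, Geo c e → Sep c e ⊆ Sep c (c * z) → ∀ K ∈ Sep c q, c * z ∈ K →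
      ∀ a f, Nb a e f → a ∈ S → e ∉ K → f ∈ K → False := by
    intro e he
    induction he with
    | refl =>
      intro _ K hK _ a f hn ha h1 h2
      have h3 := hmin _ (hn.mem_par ha)
      rw [mul_inv_cancel_left] at h3
      refine absurd h3 (not_le.2 (Set.ncard_lt_ncard ⟨fun H hH => (Sep.of_step hn hK h2 hH).1,
        fun h => ?_⟩ (finite_sep _ _)))
      exact (Sep.of_step hn hK h2 (h hK)).2 rfl
    | @step b e e' H hn hH he' _ ih =>
      intro hsub K hK hcz a f ha haS h1 h2
      have hsub' : Sep c e' ⊆ Sep c (c * z) := fun X hX => hsub (Sep.of_step_right hn hH he' hX)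
      have hHc : Hᶜ ∈ Sep c (c * z) := hsub (compl_mem_sep hH)
      obtain ⟨⟨v, g, hH1⟩, hH2, hH3⟩ := hH
      obtain ⟨⟨k, d, hK1⟩, hK2, hK3⟩ := hK
      obtain rfl := (hH1.carrier_of_nb hn fun h => hH2 (h.2 he')).1
      obtain rfl := (hK1.carrier_of_nb ha fun h => h1 (h.2 h2)).1
      have hbS : b ∈ S := label hH1.compl hHc
      by_cases hq : q ∈ Hᶜ
      · exact ih hsub' Hᶜ ⟨⟨_, _, hH1.compl⟩, fun h => h hH3, hq⟩ hHc.2.2 b e hn.symm hbS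
          (fun h => h he') hH2
      · have heK : e' ∉ K := fun h => by
          have := hn.half_eq hK1 hH1 h1 h hH2 he'
          exact hHc.2.2 (this ▸ hcz)
        have hadj : Γ.Adj a b := adj_of_crossing hK1 hH1.compl hK2 (fun h => h hH3) hcz hHc.2.2
          hK3 hq h1 hH2
        obtain ⟨t, ht1, ht2⟩ := hn.square hadj.symm ha
        exact ih hsub' K ⟨⟨_, _, hK1⟩, hK2, hK3⟩ hcz a t ht2 haS heK
          ((hK1.mem_iff_of_nb ht1 hadj.ne').1 h2)
  -- Locates an edge through which the geodesic from `c` to `c * z` enters `K`.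
  have first : ∀ x, Geo c x → Sep c x ⊆ Sep c (c * z) → c * z ∈ K → x ∈ K → False := by
    intro x hx
    induction hx with
    | refl => intro _ _ h; exact hK.2.1 h
    | @step b x x' H hn hH hx' hg ih =>
      intro hsub hcz hxK
      have hsub' : Sep c x' ⊆ Sep c (c * z) := fun X hX => hsub (Sep.of_step_right hn hH hx' hX)
      by_cases h : x' ∈ K
      · exact ih hsub' hcz h
      · have hHc : Hᶜ ∈ Sep c (c * z) := hsub (compl_mem_sep hH)
        obtain ⟨⟨v, g, hH1⟩, hH2, hH3⟩ := hH
        obtain rfl := (hH1.carrier_of_nb hn fun h => hH2 (h.2 hx')).1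
        exact main x' hg hsub' K hK hcz b x hn.symm (label hH1.compl hHc) h hxK
  exact fun h => first _ (geo c (c * z)) subset_rfl h h

theorem ncard_sep_comm (x y : Raag Γ) : (Sep x y).ncard = (Sep y x).ncard := by
  refine Set.ncard_congr (fun H _ => Hᶜ) (fun H h => compl_mem_sep h) (fun _ _ _ _ h => compl_injective h) ?_
  exact fun H h => ⟨Hᶜ, compl_mem_sep h, compl_compl H⟩

/-- The closest points of two cosets of standard subgroups. -/
theorem exists_gates (S T : Set V) (c b : Raag Γ) : ∃ c₀ b₀, c⁻¹ * c₀ ∈ par Γ S ∧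
    b⁻¹ * b₀ ∈ par Γ T ∧ ∀ K ∈ Sep c₀ b₀, (∀ z ∈ par Γ S, c₀ * z ∉ K) ∧
      ∀ z ∈ par Γ T, b₀ * z ∈ K := by
  obtain ⟨⟨c₀, b₀⟩, ⟨h1, h2⟩, hmin⟩ := WellFounded.has_min
    (measure fun p : Raag Γ × Raag Γ => (Sep p.1 p.2).ncard).wf
    {p | c⁻¹ * p.1 ∈ par Γ S ∧ b⁻¹ * p.2 ∈ par Γ T}
    ⟨(c, b), by simp [one_mem]⟩
  refine ⟨c₀, b₀, h1, h2, fun K hK => ⟨fun z hz => ?_, fun z hz => ?_⟩⟩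
  · refine notMem_of_closest (fun z hz => ?_) hK hz
    refine not_lt.1 (hmin (c₀ * z, b₀) ⟨?_, h2⟩)
    rw [← mul_assoc]; exact mul_mem h1 hz
  · have h3 := notMem_of_closest (c := b₀) (q := c₀) (fun z hz => ?_) (compl_mem_sep hK) hz
    · exact not_not.1 h3
    · rw [ncard_sep_comm b₀, ncard_sep_comm (b₀ * z)]
      refine not_lt.1 (hmin (c₀, b₀ * z) ⟨h1, ?_⟩)
      rw [← mul_assoc]; exact mul_mem h2 hz

/-- Half-spaces are convex. -/
theorem exists_carrier_mem {u w : V} {c b x y : Raag Γ} {U W : Set (Raag Γ)} (hU : IsHalf u c U)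
    (hW : IsHalf w b W) (hxW : x ∈ W) (hyW : y ∈ W) (hxU : x ∈ U) (hyU : y ∉ U) :
    ∃ e ∈ W, InCarrier u c e := by
  have hg := geo y x
  induction hg with
  | refl => exact absurd hxU hyU
  | @step v x x' H hn hH hx' _ ih =>
    by_cases h : x' ∈ U
    · refine ih ?_ h
      by_contra h1
      obtain ⟨⟨k, d, hH1⟩, hH2, hH3⟩ := hH
      have := hn.half_eq hH1 hW.compl hH2 hx' (fun h => h hxW) h1
      rw [this] at hH3
      exact hH3 hyW
    · exact ⟨x, hxW, (hU.carrier_of_nb hn fun h' => h (h'.1 hxU)).2.1⟩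

theorem InCarrier.mem_star {u : V} {c x : Raag Γ} (h : InCarrier u c x) :
    c⁻¹ * x ∈ par Γ (star Γ u) := by
  obtain ⟨a, ha, rfl | rfl⟩ := h
  · exact par_mono (Set.subset_insert _ _) ha
  · rw [← mul_assoc]
    exact mul_mem (par_mono (Set.subset_insert _ _) ha) (gen_mem_par (Set.mem_insert _ _))

/-- By convexity the carrier of `U` meets both sides of `W`, so `W` is dual to an edge inside the
star coset of `U`. Crossing walls thus have equal or adjacent vertices in the extension graph. -/
theorem exists_common_of_crossing {u w : V} {c b : Raag Γ} {U W : Set (Raag Γ)} (hU : IsHalf u c U)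
    (hW : IsHalf w b W) {p q x y : Raag Γ} (hpU : p ∉ U) (hpW : p ∉ W) (hqU : q ∈ U) (hqW : q ∈ W)
    (hxU : x ∈ U) (hxW : x ∉ W) (hyU : y ∉ U) (hyW : y ∈ W) :
    w ∈ star Γ u ∧ ∃ d, c⁻¹ * d ∈ par Γ (star Γ u) ∧ b⁻¹ * d ∈ par Γ (star Γ w) := by
  obtain ⟨e, he, he'⟩ := exists_carrier_mem hU hW hqW hyW hqU hyU
  obtain ⟨f, hf, hf'⟩ := exists_carrier_mem hU hW.compl hxW hpW hxU hpU
  have h1 : e⁻¹ * f ∈ par Γ (star Γ u) := by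
    rw [show e⁻¹ * f = (c⁻¹ * e)⁻¹ * (c⁻¹ * f) by group]
    exact mul_mem (inv_mem he'.mem_star) hf'.mem_star
  obtain ⟨h2, d, h3, h4⟩ := hW.of_par h1 e (by
    rw [mul_inv_cancel_left]; exact fun h => hf (h.1 he))
  refine ⟨h2, d, ?_, par_mono (Set.subset_insert _ _) h4⟩
  rw [show c⁻¹ * d = (c⁻¹ * e) * (e⁻¹ * d) by group]
  exact mul_mem he'.mem_star h3

theorem InCarrier.mem_of_ssubset {u w : V} {c b x : Raag Γ} {U W : Set (Raag Γ)}
    (hU : IsHalf u c U) (hW : IsHalf w b W) (h : W ⊂ U) (hx : InCarrier w b x) : x ∈ U := by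
  obtain ⟨a, ha, hx⟩ := hx
  have hn : Nb w a (a * gen Γ w) := Or.inl rfl
  have hW' : W = hs w a ∨ W = (hs w a)ᶜ := hW.congr ha
  have h1 := base_notMem_hs w a
  have h2 := base_mul_gen_mem_hs w a
  rcases hW' with hW' | hW' <;> rcases hx with rfl | rfl
  · by_contra h3
    exact h.ne (hn.half_eq hW hU (hW' ▸ h1) (hW' ▸ h2) h3 (h.1 (hW' ▸ h2)))
  · exact h.1 (hW' ▸ h2)
  · exact h.1 (hW' ▸ h1)
  · by_contra h3
    exact h.ne (hn.symm.half_eq hW hU (hW' ▸ fun h => h h2) (hW' ▸ h1) h3 (h.1 (hW' ▸ h1)))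

theorem subset_of_notMem {u k : V} {c d q : Raag Γ} {U K : Set (Raag Γ)} (hU : IsHalf u c U)
    (hK : IsHalf k d K) (h : ∀ a, c⁻¹ * a ∈ lk Γ u → a ∉ K) (hqK : q ∈ K) (hqU : q ∈ U) : K ⊆ U := by
  by_cases h1 : K = U
  · exact h1.le
  by_cases h2 : K = Uᶜ
  · exact (by rw [h2] at hqK; exact absurd hqU hqK)
  have hc : c ∉ K := h c (by rw [inv_mul_cancel]; exact one_mem _)
  intro y hy
  by_contra hyU
  obtain ⟨e, he, he'⟩ := exists_carrier_mem hU hK hqK hy hqU hyU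
  exact hc ((carrier_side hU hK (fun a ha => iff_of_false (h a ha) hc) h1 h2 he').1 he)

/-- The walls between the closest points of two nested walls are the walls between the two
walls. -/
theorem exists_bridge {u w : V} {c b : Raag Γ} {U W : Set (Raag Γ)} (hU : IsHalf u c U)
    (hW : IsHalf w b W) (h : W ⊂ U) : ∃ c₀ b₀, c⁻¹ * c₀ ∈ lk Γ u ∧ b⁻¹ * b₀ ∈ lk Γ w ∧
      ∀ K ∈ Sep c₀ b₀, W ⊆ K ∧ K ⊆ U := by
  obtain ⟨c₀, b₀, hc, hb, hg⟩ := exists_gates (Γ.neighborSet u) (Γ.neighborSet w) c b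
  refine ⟨c₀, b₀, hc, hb, fun K hK => ?_⟩
  obtain ⟨hg1, hg2⟩ := hg K hK
  obtain ⟨⟨k, d, hK1⟩, hK2, hK3⟩ := hK
  have hb' : b₀ ∈ U := InCarrier.mem_of_ssubset hU hW h ⟨b₀, hb, Or.inl rfl⟩
  have hc' : c₀ ∈ Wᶜ := InCarrier.mem_of_ssubset hW.compl hU.compl
    (compl_lt_compl_iff_lt.2 h) ⟨c₀, hc, Or.inl rfl⟩
  constructor
  · rw [← Set.compl_subset_compl]
    refine subset_of_notMem hW.compl hK1.compl (fun a ha h => h ?_) hK2 hc'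
    have := hg2 (b₀⁻¹ * a) (by
      rw [show b₀⁻¹ * a = (b⁻¹ * b₀)⁻¹ * (b⁻¹ * a) by group]; exact mul_mem (inv_mem hb) ha)
    rwa [mul_inv_cancel_left] at this
  · refine subset_of_notMem hU hK1 (fun a ha => ?_) hK3 hb'
    have := hg1 (c₀⁻¹ * a) (by
      rw [show c₀⁻¹ * a = (c⁻¹ * c₀)⁻¹ * (c⁻¹ * a) by group]; exact mul_mem (inv_mem hc) ha)
    rwa [mul_inv_cancel_left] at this

theorem conj_mem_lk_of_smul_eq {u : V} {c z : Raag Γ} {U : Set (Raag Γ)} (hU : IsHalf u c U)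
    (hz : z • U = U) : c⁻¹ * z * c ∈ lk Γ u := by
  have := hU.smul z
  rw [hz] at this
  rw [mul_assoc]
  exact (this.unique hU).2

/-- A nontrivial element stabilizing two walls forces a third wall to cross both. -/
theorem eq_one_or_exists_of_smul_eq {u w : V} {c b z : Raag Γ} {U W : Set (Raag Γ)}
    (hU : IsHalf u c U) (hW : IsHalf w b W) (hzU : z • U = U) (hzW : z • W = W) :
    z = 1 ∨ ∃ (t : V) (c' b' : Raag Γ), c⁻¹ * c' ∈ lk Γ u ∧ b⁻¹ * b' ∈ lk Γ w ∧ Γ.Adj u t ∧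
      Γ.Adj w t ∧ c'⁻¹ * b' ∈ lk Γ t := by
  by_cases hz1 : z = 1
  · exact Or.inl hz1
  right
  obtain ⟨c₀, b₀, hc, hb, hg⟩ := exists_gates (Γ.neighborSet u) (Γ.neighborSet w) c b
  have conj : ∀ {u : V} {c c₀ : Raag Γ}, c⁻¹ * c₀ ∈ lk Γ u → c⁻¹ * z * c ∈ lk Γ u →
      c₀⁻¹ * z * c₀ ∈ lk Γ u := by
    intro u c c₀ h h'
    rw [show c₀⁻¹ * z * c₀ = (c⁻¹ * c₀)⁻¹ * (c⁻¹ * z * c) * (c⁻¹ * c₀) by group]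
    exact mul_mem (mul_mem (inv_mem h) h') h
  have hzc := conj hc (conj_mem_lk_of_smul_eq hU hzU)
  have hzb := conj hb (conj_mem_lk_of_smul_eq hW hzW)
  have ec : c₀ * (c₀⁻¹ * z * c₀) = z * c₀ := by group
  have eb : b₀ * (b₀⁻¹ * z * b₀) = z * b₀ := by group
  -- Since `z` preserves both link cosets, the gate property forbids `K` to separate the cosets. So
  -- `K` also separates `b₀` from `z * b₀`, and is dual to an edge in each coset.
  obtain ⟨K, hK⟩ : ∃ K, K ∈ Sep c₀ (z * c₀) := by
    by_contra h
    exact hz1 (mul_eq_right.1 (eq_of_sep_empty (not_exists.1 h)).symm)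
  obtain ⟨⟨t, d, hK1⟩, hK2, hK3⟩ := id hK
  have h1 : b₀ ∉ K := fun h => (hg K ⟨⟨t, d, hK1⟩, hK2, h⟩).1 _ hzc (by rwa [ec])
  have h2 : z * b₀ ∈ K := by
    by_contra h
    have h3 : z⁻¹ • Kᶜ ∈ Sep c₀ b₀ := by
      have : Kᶜ ∈ Sep (z * c₀) (z * b₀) := ⟨⟨t, d, hK1.compl⟩, fun h => h hK3, h⟩
      simpa using smul_mem_sep this z⁻¹
    have h4 := (hg _ h3).1 _ (inv_mem hzc)
    rw [Set.mem_smul_set_iff_inv_smul_mem, inv_inv, smul_eq_mul,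
      show z * (c₀ * (c₀⁻¹ * z * c₀)⁻¹) = c₀ by group] at h4
    exact h4 hK2
  obtain ⟨h3, c', h4, h5⟩ := hK1.of_par hzc c₀ (by rw [ec]; exact fun h => hK2 (h.2 hK3))
  obtain ⟨h6, b', h7, h8⟩ := hK1.of_par hzb b₀ (by rw [eb]; exact fun h => h1 (h.2 h2))
  refine ⟨t, c', b', ?_, ?_, h3, h6, ?_⟩
  · rw [show c⁻¹ * c' = (c⁻¹ * c₀) * (c₀⁻¹ * c') by group]; exact mul_mem hc h4
  · rw [show b⁻¹ * b' = (b⁻¹ * b₀) * (b₀⁻¹ * b') by group]; exact mul_mem hb h7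
  · rw [show c'⁻¹ * b' = (d⁻¹ * c')⁻¹ * (d⁻¹ * b') by group]; exact mul_mem (inv_mem h5) h8

/-! ### Axes of half-spaces -/

section Axis

/-- The label `v` is the label of the half-space `H`. -/
def HasLabel (v : V) (H : Set (Raag Γ)) : Prop := ∃ g, IsHalf v g H

theorem HasLabel.compl {v : V} {H : Set (Raag Γ)} (h : HasLabel v H) : HasLabel v Hᶜ :=
  ⟨_, h.choose_spec.compl⟩

theorem HasLabel.smul {v : V} {H : Set (Raag Γ)} (h : HasLabel v H) (k : Raag Γ) :
    HasLabel v (k • H) := ⟨_, h.choose_spec.smul k⟩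

theorem HasLabel.exists_notMem {v : V} {H : Set (Raag Γ)} (h : HasLabel v H) : ∃ x, x ∉ H := by
  obtain ⟨g, rfl | rfl⟩ := h
  · exact ⟨g, base_notMem_hs v g⟩
  · exact ⟨_, fun h => h (base_mul_gen_mem_hs v g)⟩

theorem HasLabel.exists_mem {v : V} {H : Set (Raag Γ)} (h : HasLabel v H) : ∃ x, x ∈ H := by
  obtain ⟨x, hx⟩ := h.compl.exists_notMem
  exact ⟨x, not_not.1 hx⟩

theorem smul_ssubset_smul_iff {a : Raag Γ} {S T : Set (Raag Γ)} : a • S ⊂ a • T ↔ S ⊂ T := by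
  rw [ssubset_iff_subset_not_subset, ssubset_iff_subset_not_subset,
    Set.smul_set_subset_smul_set_iff, Set.smul_set_subset_smul_set_iff]

theorem ssubset_smul_inv {z : Raag Γ} {U : Set (Raag Γ)} (h : z • U ⊂ U) : U ⊂ z⁻¹ • U := by
  have := (smul_ssubset_smul_iff (a := z⁻¹)).2 h
  rwa [inv_smul_smul] at this

theorem smul_compl_ssubset {z : Raag Γ} {U : Set (Raag Γ)} (h : z • U ⊂ U) :
    z⁻¹ • Uᶜ ⊂ Uᶜ := by
  rw [Set.smul_set_compl]
  exact compl_lt_compl_iff_lt.2 (ssubset_smul_inv h)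

theorem zpow_smul_antitone {h : Raag Γ} {U : Set (Raag Γ)} (hU : h • U ⊂ U) :
    StrictAnti fun k : ℤ => h ^ k • U := by
  refine strictAnti_int_of_succ_lt fun k => ?_
  rw [zpow_add_one, mul_smul]
  exact smul_ssubset_smul_iff.2 hU

/-- Otherwise infinitely many half-spaces `h ^ n • U` would separate a point outside `U` from `a`.
-/
theorem exists_notMem_zpow_smul {v : V} {h : Raag Γ} {U : Set (Raag Γ)} (hv : HasLabel v U)
    (hU : h • U ⊂ U) (a : Raag Γ) : ∃ n : ℕ, a ∉ h ^ (n : ℤ) • U := by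
  by_contra hc
  push Not at hc
  obtain ⟨e, he⟩ := hv.exists_notMem
  refine Set.infinite_of_injective_forall_mem (f := fun n : ℕ => h ^ (n : ℤ) • U)
    (fun m n hmn => ?_) (fun n => ?_) (finite_sep e a)
  · exact_mod_cast (zpow_smul_antitone hU).injective hmn
  · refine ⟨⟨v, hv.smul _⟩, fun hn => he ?_, hc n⟩
    have := (zpow_smul_antitone hU).antitone (Int.natCast_nonneg n) hn
    simpa using this

theorem exists_idx {v : V} {h : Raag Γ} {U : Set (Raag Γ)} (hv : HasLabel v U)
    (hU : h • U ⊂ U) (a : Raag Γ) : ∃ k : ℤ, ∀ j : ℤ, a ∈ h ^ j • U ↔ j ≤ k := by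
  obtain ⟨n, hn⟩ := exists_notMem_zpow_smul hv hU a
  obtain ⟨m, hm⟩ := exists_notMem_zpow_smul hv.compl (smul_compl_ssubset hU) a
  rw [Set.smul_set_compl, Set.mem_compl_iff, not_not, inv_zpow, ← zpow_neg] at hm
  have mono := (zpow_smul_antitone hU).antitone
  obtain ⟨k, hk1, hk2⟩ := Int.exists_greatest_of_bdd (P := fun j => a ∈ h ^ j • U)
    ⟨n, fun j hj => by
      by_contra h'
      exact hn (mono (not_le.1 h').le hj)⟩ ⟨_, hm⟩
  exact ⟨k, fun j => ⟨hk2 j, fun hj => mono hj hk1⟩⟩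

open Classical in
/-- The position of a point along the sequence of half-spaces `h ^ k • U`. -/
noncomputable def idx (h : Raag Γ) (U : Set (Raag Γ)) (a : Raag Γ) : ℤ :=
  if hk : ∃ k : ℤ, ∀ j : ℤ, a ∈ h ^ j • U ↔ j ≤ k then hk.choose else 0

theorem mem_zpow_smul_iff {v : V} {h : Raag Γ} {U : Set (Raag Γ)} (hv : HasLabel v U)
    (hU : h • U ⊂ U) (a : Raag Γ) (j : ℤ) : a ∈ h ^ j • U ↔ j ≤ idx h U a := by
  unfold idx
  rw [dif_pos (exists_idx hv hU a)]
  exact (exists_idx hv hU a).choose_spec j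

theorem idx_zpow_mul {v : V} {h : Raag Γ} {U : Set (Raag Γ)} (hv : HasLabel v U)
    (hU : h • U ⊂ U) (a : Raag Γ) (m : ℤ) : idx h U (h ^ m * a) = idx h U a + m := by
  have key : ∀ j : ℤ, j ≤ idx h U (h ^ m * a) ↔ j ≤ idx h U a + m := by
    intro j
    rw [← mem_zpow_smul_iff hv hU, ← sub_le_iff_le_add, ← mem_zpow_smul_iff hv hU,
      Set.mem_smul_set_iff_inv_smul_mem, Set.mem_smul_set_iff_inv_smul_mem, smul_eq_mul,
      smul_eq_mul, ← mul_assoc, ← zpow_neg, ← zpow_neg, ← zpow_add]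
    rw [show -j + m = -(j - m) by ring]
  exact le_antisymm ((key _).1 le_rfl) ((key _).2 le_rfl)

theorem idx_congr {v : V} {h : Raag Γ} {U : Set (Raag Γ)} (hv : HasLabel v U)
    (hU : h • U ⊂ U) {a b : Raag Γ} (hab : ∀ H, HasLabel v H → (a ∈ H ↔ b ∈ H)) :
    idx h U a = idx h U b := by
  have key : ∀ j : ℤ, j ≤ idx h U a ↔ j ≤ idx h U b := by
    intro j
    rw [← mem_zpow_smul_iff hv hU, ← mem_zpow_smul_iff hv hU]
    exact hab _ (hv.smul _)
  exact le_antisymm ((key _).1 le_rfl) ((key _).2 le_rfl)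

/-- High powers of `h` lie in both half-spaces and very negative ones in neither, so they are
neither disjoint nor covering; not crossing leaves only nesting. -/
theorem comparable_of_axis {u w : V} {h : Raag Γ} {U W : Set (Raag Γ)} (hu : HasLabel u U)
    (hw : HasLabel w W) (hU : h • U ⊂ U) (hW : h • W ⊂ W) (huw : ¬ Γ.Adj u w) :
    U ⊆ W ∨ W ⊆ U := by
  have key : ∀ {v} {U : Set (Raag Γ)}, HasLabel v U → h • U ⊂ U → ∀ m : ℤ,
      (h ^ m ∈ U ↔ 0 ≤ idx h U 1 + m) := by
    intro v U hv hU m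
    have := mem_zpow_smul_iff hv hU (h ^ m * 1) 0
    rwa [idx_zpow_mul hv hU, zpow_zero, one_smul, mul_one] at this
  obtain ⟨c, hc⟩ := hu
  obtain ⟨b, hb⟩ := hw
  have k1 := key ⟨c, hc⟩ hU
  have k2 := key ⟨b, hb⟩ hW
  rcases noncrossing hc hb huw with h1 | h1 | h1 | h1
  · exact Or.inl h1
  · exact Or.inr h1
  · have hm := (k1 (max (-idx h U 1) (-idx h W 1))).2 (by have := le_max_left (-idx h U 1) (-idx h W 1); linarith)
    exact absurd ((k2 _).2 (by have := le_max_right (-idx h U 1) (-idx h W 1); linarith)) (h1 hm)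
  · have hm : h ^ (min (-idx h U 1) (-idx h W 1) - 1) ∉ U := fun hh => by
      have := (k1 _).1 hh
      have := min_le_left (-idx h U 1) (-idx h W 1); linarith
    have := (k2 _).1 (h1 hm)
    have := min_le_right (-idx h U 1) (-idx h W 1); linarith

/-- Two axes with labels that are not adjacent interleave. -/
theorem exists_idx_sub {u w : V} {h : Raag Γ} {U W : Set (Raag Γ)} (hu : HasLabel u U)
    (hw : HasLabel w W) (hU : h • U ⊂ U) (hW : h • W ⊂ W) (huw : ¬ Γ.Adj u w) :
    ∃ k, ∀ a, idx h U a + k ≤ idx h W a ∧ idx h W a ≤ idx h U a + k + 1 := by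
  have hk : ∀ k : ℤ, h • h ^ k • W ⊂ h ^ k • W := fun k => by
    rw [smul_smul, ← zpow_one_add, add_comm, zpow_add_one, mul_smul]
    exact smul_ssubset_smul_iff.2 hW
  have hcomp := fun k => comparable_of_axis hu (hw.smul (h ^ k)) hU (hk k) huw
  obtain ⟨x, hx⟩ := hu.exists_mem
  obtain ⟨y, hy⟩ := hu.exists_notMem
  -- With `k` maximal, `h ^ (k + 1) • W ⊆ U ⊆ h ^ k • W`; translating these inclusions gives both
  -- inequalities.
  obtain ⟨k, hk1, hk2⟩ := Int.exists_greatest_of_bdd (P := fun k : ℤ => U ⊆ h ^ k • W)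
    ⟨idx h W x, fun j hj => (mem_zpow_smul_iff hw hW x j).1 (hj hx)⟩
    ⟨idx h W y, (hcomp _).resolve_right fun h1 => hy (h1 ((mem_zpow_smul_iff hw hW y _).2 le_rfl))⟩
  have hk3 : h ^ (k + 1) • W ⊆ U := (hcomp _).resolve_left fun h1 => by
    have := hk2 _ h1; omega
  refine ⟨k, fun a => ⟨?_, ?_⟩⟩
  · rw [← mem_zpow_smul_iff hw hW, zpow_add, mul_smul]
    exact Set.smul_set_mono hk1 ((mem_zpow_smul_iff hu hU a _).2 le_rfl)
  · have := (mem_zpow_smul_iff hu hU a (idx h W a - k - 1)).1 (by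
      refine Set.smul_set_mono hk3 ?_
      rw [smul_smul, ← zpow_add]
      exact (mem_zpow_smul_iff hw hW a _).2 (by omega))
    omega

end Axis

/-! ### Centralizers of vertices -/

section Centralizer

theorem gen_ne_one (v : V) : gen Γ v ≠ 1 := fun h => gen_notMem_lk v (h ▸ one_mem _)

theorem gen_smul_ssubset (v : V) : gen Γ v • hs v (1 : Raag Γ) ⊂ hs v 1 := by
  have e : gen Γ v • hs v (1 : Raag Γ) = hs v (gen Γ v) := by rw [smul_hs, mul_one]
  have m1 : gen Γ v ∈ hs v (1 : Raag Γ) := by simpa using base_mul_gen_mem_hs v (1 : Raag Γ)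
  have m2 : gen Γ v ∉ hs v (gen Γ v) := base_notMem_hs _ _
  have m3 : gen Γ v * gen Γ v ∈ hs v (gen Γ v) := base_mul_gen_mem_hs _ _
  have m4 : gen Γ v * gen Γ v ∈ hs v (1 : Raag Γ) :=
    ((mul_gen_mem_hs_iff v v 1 (gen Γ v)).2 (fun h => gen_notMem_lk v (by
      simpa using h.2))).2 m1
  have m5 : (1 : Raag Γ) ∉ hs v (gen Γ v) := fun h => m2 (by
    have := ((mul_gen_mem_hs_iff v v (gen Γ v) 1).2 (fun h => gen_notMem_lk v (by
      simpa using h.2))).2 h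
    simpa using this)
  rw [e]
  refine ⟨?_, fun h => m2 (h m1)⟩
  rcases noncrossing (isHalf_hs v (gen Γ v)) (isHalf_hs v (1 : Raag Γ)) (fun h => h.ne rfl) with
    h | h | h | h
  · exact h
  · exact absurd (h m1) m2
  · exact absurd m4 (h m3)
  · exact absurd (h m5) (base_notMem_hs _ _)

/-- The centralizer of a vertex is generated by its star. -/
theorem commute_gen_iff {v : V} {z : Raag Γ} : Commute (gen Γ v) z ↔ z ∈ par Γ (star Γ v) := by
  refine ⟨fun h => ?_, commute_of_mem_star⟩
  have hv : HasLabel v (hs v (1 : Raag Γ)) := ⟨1, isHalf_hs _ _⟩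
  have hU := gen_smul_ssubset (Γ := Γ) v
  have hg : gen Γ v ∈ par Γ (star Γ v) := gen_mem_par (Set.mem_insert _ _)
  -- The power of `v` is chosen so that the step from `z₀` to `v * z₀ = z₀ * v` crosses the wall at
  -- `1`; this places `z₀` in the link subgroup.
  set k := idx (gen Γ v) (hs v 1) z with hk
  set z₀ := gen Γ v ^ (-(k + 1)) * z with hz₀
  have h1 : z₀ ∉ hs v (1 : Raag Γ) := fun h1 => by
    have := (mem_zpow_smul_iff hv hU z₀ 0).1 (by simpa using h1)
    rw [hz₀, idx_zpow_mul hv hU] at this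
    omega
  have h2 : gen Γ v * z₀ ∈ hs v (1 : Raag Γ) := by
    have := (mem_zpow_smul_iff hv hU (gen Γ v ^ (1 : ℤ) * z₀) 0).2 (by
      rw [hz₀, idx_zpow_mul hv hU, idx_zpow_mul hv hU]; omega)
    simpa using this
  have h3 : Commute (gen Γ v) z₀ := ((Commute.refl _).zpow_right _).mul_right h
  rw [h3.eq] at h2
  have h4 := ((isHalf_hs v (1 : Raag Γ)).eq_of_nb_gen (u := v) (x := z₀) fun h => h1 (h.1 h2)).2
  have h5 : z₀ ∈ par Γ (star Γ v) := by
    have := inv_mem h4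
    rw [mul_one, inv_inv] at this
    exact par_mono (Set.subset_insert _ _) this
  rw [show z = gen Γ v ^ (k + 1) * z₀ by rw [hz₀]; group]
  exact mul_mem (zpow_mem hg _) h5

open Classical in
theorem exists_retraction (Γ : SimpleGraph V) (S : Set V) : ∃ ρ : Raag Γ →* Raag Γ,
    (∀ z, ρ z ∈ par Γ S) ∧ (∀ z ∈ par Γ S, ρ z = z) ∧ ∀ v ∉ S, ρ (gen Γ v) = 1 := by
  obtain ⟨ρ, hρ⟩ := exists_hom (Γ := Γ) (fun v => if v ∈ S then gen Γ v else 1) (by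
    intro v w h
    split_ifs
    · exact commute_gen h
    · exact Commute.one_right _
    · exact Commute.one_left _
    · exact Commute.one_left _)
  refine ⟨ρ, fun z => ?_, fun z hz => ?_, fun v hv => by rw [hρ, if_neg hv]⟩
  · have hz : z ∈ Subgroup.closure (Set.range (gen Γ)) := by rw [closure_range_gen]; trivial
    induction hz using Subgroup.closure_induction with
    | mem x hx =>
      obtain ⟨u, rfl⟩ := hx
      rw [hρ]
      split_ifs with h
      · exact gen_mem_par h
      · exact one_mem _
    | one => rw [map_one]; exact one_mem _
    | mul x y _ _ hx hy => rw [map_mul]; exact mul_mem hx hy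
    | inv x _ hx => rw [map_inv]; exact inv_mem hx
  · induction hz using Subgroup.closure_induction with
    | mem x hx => obtain ⟨u, hu, rfl⟩ := hx; rw [hρ, if_pos hu]
    | one => exact map_one _
    | mul x y _ _ hx hy => rw [map_mul, hx, hy]
    | inv x _ hx => rw [map_inv, hx]

/-- The conjugate lies in the star subgroup of `v`, hence is fixed by the retraction `ρ` onto it. So
`k` may be replaced by `ρ k`, and `w` is not killed by `ρ`. -/
theorem exists_of_commute_conj {v w : V} {k : Raag Γ} (h : Commute (gen Γ v) (k * gen Γ w * k⁻¹)) :
    w ∈ star Γ v ∧ ∃ c ∈ par Γ (star Γ v), k⁻¹ * c ∈ par Γ (star Γ w) ∧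
      c * gen Γ w * c⁻¹ = k * gen Γ w * k⁻¹ := by
  obtain ⟨ρ, h1, h2, h3⟩ := exists_retraction Γ (star Γ v)
  have h4 := h2 _ (commute_gen_iff.1 h)
  rw [map_mul, map_mul, map_inv] at h4
  have hw : w ∈ star Γ v := by
    by_contra hw
    rw [h3 w hw, mul_one, mul_inv_cancel, eq_comm, conj_eq_one_iff] at h4
    exact gen_ne_one w h4
  rw [h2 _ (gen_mem_par hw)] at h4
  refine ⟨hw, ρ k, h1 k, commute_gen_iff.1 ?_, h4⟩
  change gen Γ w * (k⁻¹ * ρ k) = k⁻¹ * ρ k * gen Γ w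
  calc gen Γ w * (k⁻¹ * ρ k) = k⁻¹ * (k * gen Γ w * k⁻¹) * ρ k := by group
    _ = k⁻¹ * (ρ k * gen Γ w * (ρ k)⁻¹) * ρ k := by rw [h4]
    _ = _ := by group

end Centralizer

/-! ### The extension graph in terms of star cosets -/

section ExtensionGraph

/-- The vertex `g v g⁻¹` of the extension graph. -/
def ev (v : V) (g : Raag Γ) : ExtensionVertex Γ := ExtensionVertex.mk v g⁻¹

theorem ev_val (v : V) (g : Raag Γ) : (ev v g).1 = g * gen Γ v * g⁻¹ := by
  change g⁻¹⁻¹ * gen Γ v * g⁻¹ = _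
  rw [inv_inv]

theorem exists_ev (x : ExtensionVertex Γ) : ∃ v g, x = ev v g := by
  obtain ⟨a, v, g, h⟩ := x
  exact ⟨v, g⁻¹, Subtype.ext (by rw [ev_val, inv_inv]; exact h)⟩

theorem ev_mul (v : V) (k g : Raag Γ) : ev v (k * g) = ev v g <• k⁻¹ := by
  refine Subtype.ext ?_
  change _ = k⁻¹⁻¹ * (ev v g).1 * k⁻¹
  rw [ev_val, ev_val]; group

theorem ev_eq_iff {v w : V} {a b : Raag Γ} :
    ev v a = ev w b ↔ v = w ∧ a⁻¹ * b ∈ par Γ (star Γ v) := by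
  constructor
  · intro h
    have h1 := congrArg Subtype.val h
    rw [ev_val, ev_val] at h1
    have h2 : (a⁻¹ * b) * gen Γ w * (a⁻¹ * b)⁻¹ = gen Γ v := by
      calc _ = a⁻¹ * (b * gen Γ w * b⁻¹) * a := by group
        _ = _ := by rw [← h1]; group
    obtain ⟨-, c, hc, -, h3⟩ := exists_of_commute_conj (v := v) (w := w) (k := a⁻¹ * b)
      (by rw [h2])
    rw [h2, mul_inv_eq_iff_eq_mul, (commute_of_mem_star hc).eq] at h3
    obtain rfl := gen_injective Γ (mul_left_cancel h3)
    exact ⟨rfl, commute_gen_iff.1 (mul_inv_eq_iff_eq_mul.1 h2).symm⟩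
  · rintro ⟨rfl, h⟩
    refine Subtype.ext ?_
    rw [ev_val, ev_val]
    have := (commute_of_mem_star h).eq
    calc a * gen Γ v * a⁻¹ = a * (gen Γ v * (a⁻¹ * b)) * b⁻¹ := by group
      _ = a * (a⁻¹ * b * gen Γ v) * b⁻¹ := by rw [this]
      _ = _ := by group

theorem ev_congr {v : V} {a b : Raag Γ} (h : a⁻¹ * b ∈ par Γ (star Γ v)) : ev v a = ev v b :=
  ev_eq_iff.2 ⟨rfl, h⟩

theorem ev_congr_lk {v : V} {a b : Raag Γ} (h : a⁻¹ * b ∈ lk Γ v) : ev v a = ev v b :=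
  ev_congr (par_mono (Set.subset_insert _ _) h)

theorem Nb.ev_eq {u : V} {x y : Raag Γ} (h : Nb u x y) : ev u x = ev u y :=
  ev_congr (h.mem_par (Set.mem_insert _ _))

theorem exists_of_ev_adj {v w : V} {a b : Raag Γ} (h : (extensionGraph Γ).Adj (ev v a) (ev w b)) :
    Γ.Adj v w ∧ ∃ c, a⁻¹ * c ∈ par Γ (star Γ v) ∧ b⁻¹ * c ∈ par Γ (star Γ w) := by
  obtain ⟨hne, hc⟩ := h
  rw [ev_val, ev_val] at hc
  have h1 : Commute (gen Γ v) ((a⁻¹ * b) * gen Γ w * (a⁻¹ * b)⁻¹) := by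
    have := hc.eq
    change _ = _
    calc _ = a⁻¹ * ((a * gen Γ v * a⁻¹) * (b * gen Γ w * b⁻¹)) * a := by group
      _ = a⁻¹ * ((b * gen Γ w * b⁻¹) * (a * gen Γ v * a⁻¹)) * a := by rw [this]
      _ = _ := by group
  obtain ⟨h2, c, h3, h4, h5⟩ := exists_of_commute_conj h1
  have key : b⁻¹ * (a * c) = (a⁻¹ * b)⁻¹ * c := by group
  refine ⟨?_, a * c, by rwa [inv_mul_cancel_left], key ▸ h4⟩
  rcases h2 with rfl | h2
  · refine absurd ?_ hne
    rw [ev_congr (a := a) (b := a * c) (by rwa [inv_mul_cancel_left]), eq_comm]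
    exact ev_congr (key ▸ h4)
  · exact h2

theorem ev_adj {v w : V} (h : Γ.Adj v w) (g : Raag Γ) :
    (extensionGraph Γ).Adj (ev v g) (ev w g) := extensionGraph_adj_mk _ h

/-- The distance in the extension graph. -/
noncomputable abbrev ed (x y : ExtensionVertex Γ) : ℕ := (extensionGraph Γ).dist x y

theorem ed_comm (x y : ExtensionVertex Γ) : ed x y = ed y x := SimpleGraph.dist_comm

theorem ed_star {u v : V} (h : u ∈ star Γ v) (g : Raag Γ) : ed (ev u g) (ev v g) ≤ 1 := by
  rcases h with rfl | h
  · simp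
  · exact (SimpleGraph.dist_eq_one_iff_adj.2 (ev_adj h.symm g)).le

theorem ed_triangle (hΓ : Γ.Connected) (x y z : ExtensionVertex Γ) : ed x z ≤ ed x y + ed y z :=
  (extensionGraph_connected hΓ).dist_triangle

theorem ed_ev_le_diam [Finite V] (hΓ : Γ.Connected) (v w : V) (g : Raag Γ) :
    ed (ev v g) (ev w g) ≤ Γ.diam := by
  have := hΓ.nonempty
  have h1 : ed (ev v g) (ev w g) ≤ Γ.dist v w := by
    obtain ⟨p, hp⟩ := hΓ.exists_walk_length_eq_dist v w
    let f : Γ →g extensionGraph Γ := ⟨fun a => ev a g, fun h => ev_adj h g⟩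
    rw [← hp, ← SimpleGraph.Walk.length_map f p]
    exact SimpleGraph.dist_le _
  exact h1.trans (SimpleGraph.dist_le_diam (SimpleGraph.connected_iff_ediam_ne_top.1 hΓ))

theorem ed_smul (hΓ : Γ.Connected) (k : Raag Γ) (x y : ExtensionVertex Γ) :
    ed (x <• k) (y <• k) = ed x y := by
  refine le_antisymm (extensionGraph_dist_smul_le hΓ _ x y) ?_
  have := extensionGraph_dist_smul_le hΓ (MulOpposite.op k)⁻¹ (x <• k) (y <• k)
  rwa [inv_smul_smul, inv_smul_smul] at this

theorem ed_ev_mul (hΓ : Γ.Connected) (v w : V) (k a b : Raag Γ) :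
    ed (ev v (k * a)) (ev w (k * b)) = ed (ev v a) (ev w b) := by
  rw [ev_mul, ev_mul, ed_smul hΓ]

/-- A wall separating two points is close to any path of stars between them. -/
theorem ed_le_of_separates (hΓ : Γ.Connected) {u v w : V} {c p q : Raag Γ} {H : Set (Raag Γ)}
    (hH : IsHalf u c H) (hpq : ¬ (p ∈ H ↔ q ∈ H)) :
    ed (ev u c) (ev v p) ≤ ed (ev v p) (ev w q) + 1 := by
  -- A wall crossing a star coset is dual to one of its edges, so its vertex is at distance at most
  -- 1 from the vertex of the coset.
  have single : ∀ {v : V} {p q : Raag Γ}, p⁻¹ * q ∈ par Γ (star Γ v) → ¬ (p ∈ H ↔ q ∈ H) →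
      ed (ev u c) (ev v p) ≤ 1 := by
    intro v p q h1 h2
    obtain ⟨h3, b, h4, h5⟩ := hH.of_par h1 p (by rwa [mul_inv_cancel_left])
    rw [ev_congr h4, ev_congr_lk h5]
    exact ed_star h3 b
  obtain ⟨W, hW⟩ := (extensionGraph_connected hΓ).exists_walk_length_eq_dist (ev v p) (ev w q)
  change _ ≤ (extensionGraph Γ).dist _ _ + 1
  rw [← hW]
  have key : ∀ {x y : ExtensionVertex Γ} (W : (extensionGraph Γ).Walk x y) (v p), x = ev v p →
      y = ev w q → ¬ (p ∈ H ↔ q ∈ H) → ed (ev u c) (ev v p) ≤ W.length + 1 := by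
    intro x y W
    induction W with
    | nil =>
      rintro v p rfl h2 h3
      obtain ⟨rfl, h4⟩ := ev_eq_iff.1 h2
      simpa using single h4 h3
    | @cons x x' y h W ih =>
      rintro v p rfl h2 h3
      obtain ⟨v', p', rfl⟩ := exists_ev x'
      obtain ⟨h4, d, h5, h6⟩ := exists_of_ev_adj h
      rw [SimpleGraph.Walk.length_cons]
      by_cases h7 : p ∈ H ↔ d ∈ H
      · have h8 := ih v' d (ev_congr h6) h2 (fun h => h3 (h7.trans h))
        have h9 := ed_triangle hΓ (ev u c) (ev v' d) (ev v d)
        rw [ev_congr h5]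
        have := ed_star (Γ := Γ) (u := v') (v := v) (Or.inr h4) d
        omega
      · exact (single h5 h7).trans (by omega)
  exact key W v p rfl rfl hpq

end ExtensionGraph

/-! ### Windows and far pairs -/

/-- The half-spaces that separate `e * p` from `f * q` for all `e, f ∈ E`. -/
def Window (E : Set (Raag Γ)) (p q : Raag Γ) : Set (Set (Raag Γ)) :=
  {H | (∃ v, HasLabel v H) ∧ ∀ e ∈ E, e * p ∉ H ∧ e * q ∈ H}

/-- The labels of a set of half-spaces. -/
def labels (M : Set (Set (Raag Γ))) : Set V := {t | ∃ H ∈ M, HasLabel t H}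

/-- `M` contains two half-spaces whose walls are at distance at least three. -/
def FarPair (M : Set (Set (Raag Γ))) : Prop :=
  ∃ U ∈ M, ∃ W ∈ M, ∃ u c w b, IsHalf u c U ∧ IsHalf w b W ∧ 3 ≤ ed (ev u c) (ev w b)

theorem Window.mem_sep {E : Set (Raag Γ)} {p q : Raag Γ} (hE : 1 ∈ E) {H : Set (Raag Γ)}
    (h : H ∈ Window E p q) : H ∈ Sep p q := by
  obtain ⟨⟨v, g, h1⟩, h2⟩ := h
  exact ⟨⟨v, g, h1⟩, by simpa using h2 1 hE⟩

theorem Window.convex {E : Set (Raag Γ)} {p q : Raag Γ} {U W K : Set (Raag Γ)}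
    (hU : U ∈ Window E p q) (hW : W ∈ Window E p q) (hK : ∃ v, HasLabel v K) (h1 : W ⊆ K)
    (h2 : K ⊆ U) : K ∈ Window E p q :=
  ⟨hK, fun e he => ⟨fun h => (hU.2 e he).1 (h2 h), h1 (hW.2 e he).2⟩⟩

theorem Window.smul_mem_sep {E : Set (Raag Γ)} {p q z : Raag Γ} {U : Set (Raag Γ)}
    (hU : U ∈ Window E p q) (hz : z⁻¹ ∈ E) : z • U ∈ Sep p q := by
  obtain ⟨⟨v, hv⟩, h⟩ := hU
  obtain ⟨g, hg⟩ := hv.smul z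
  refine ⟨⟨v, g, hg⟩, ?_⟩
  rw [Set.mem_smul_set_iff_inv_smul_mem, Set.mem_smul_set_iff_inv_smul_mem]
  exact h _ hz

theorem comparable_of_sep {u w : V} {p q : Raag Γ} {U W : Set (Raag Γ)} (hu : HasLabel u U)
    (hw : HasLabel w W) (hU : U ∈ Sep p q) (hW : W ∈ Sep p q) (huw : ¬ Γ.Adj u w) :
    U ⊆ W ∨ W ⊆ U := by
  obtain ⟨c, hc⟩ := hu
  obtain ⟨b, hb⟩ := hw
  rcases noncrossing hc hb huw with h | h | h | h
  · exact Or.inl h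
  · exact Or.inr h
  · exact absurd hW.2.2 (h hU.2.2)
  · exact absurd (h hU.2.1) hW.2.1

theorem ed_le_one_of_incomparable {u w : V} {p q c b : Raag Γ} {U W : Set (Raag Γ)}
    (hu : IsHalf u c U) (hw : IsHalf w b W) (hU : U ∈ Sep p q) (hW : W ∈ Sep p q)
    (h1 : ¬ U ⊆ W) (h2 : ¬ W ⊆ U) : ed (ev u c) (ev w b) ≤ 1 := by
  obtain ⟨x, hx, hx'⟩ := Set.not_subset.1 h1
  obtain ⟨y, hy, hy'⟩ := Set.not_subset.1 h2
  obtain ⟨h3, d, h4, h5⟩ := exists_common_of_crossing hu hw hU.2.1 hW.2.1 hU.2.2 hW.2.2 hx hx' hy' hy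
  rw [ev_congr h4, ev_congr h5, ed_comm]
  exact ed_star h3 d

theorem Window.exists_bridge {E : Set (Raag Γ)} {p q : Raag Γ} {u w : V} {c b : Raag Γ}
    {U W : Set (Raag Γ)} (hU : U ∈ Window E p q) (hW : W ∈ Window E p q) (hu : IsHalf u c U)
    (hw : IsHalf w b W) (h : W ⊂ U) : ∃ c₀ b₀, c⁻¹ * c₀ ∈ lk Γ u ∧ b⁻¹ * b₀ ∈ lk Γ w ∧
      c₀⁻¹ * b₀ ∈ par Γ (labels (Window E p q)) := by
  obtain ⟨c₀, b₀, h1, h2, h3⟩ := Raag.exists_bridge hu hw h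
  refine ⟨c₀, b₀, h1, h2, mem_par_of_sep fun v g K hK hK' => ⟨K, ?_, g, hK⟩⟩
  exact Window.convex hU hW ⟨v, g, hK⟩ (h3 K hK').1 (h3 K hK').2

/-- If all labels were in the star of `v`, the bridge between two nested walls would stay in one
star coset of `v`. Both walls would be within 1 of that vertex, against the distance 3. -/
theorem FarPair.exists_label_notMem_star (hΓ : Γ.Connected) {E : Set (Raag Γ)} (hE : 1 ∈ E)
    {p q : Raag Γ} (hM : FarPair (Window E p q)) (v : V) :
    ∃ t ∈ labels (Window E p q), t ∉ star Γ v := by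
  by_contra hc
  push Not at hc
  have key : ∀ {u w : V} {c b : Raag Γ} {U W : Set (Raag Γ)}, U ∈ Window E p q → W ∈ Window E p q →
      IsHalf u c U → IsHalf w b W → W ⊂ U → ed (ev u c) (ev w b) ≤ 2 := by
    intro u w c b U W hU hW hu hw h
    obtain ⟨c₀, b₀, h1, h2, h3⟩ := Window.exists_bridge hU hW hu hw h
    have h4 : ev v c₀ = ev v b₀ := ev_congr (par_mono hc h3)
    rw [ev_congr_lk h1, ev_congr_lk h2]
    have h5 := ed_star (Γ := Γ) (hc u ⟨U, hU, c, hu⟩) c₀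
    have h6 := ed_star (Γ := Γ) (hc w ⟨W, hW, b, hw⟩) b₀
    rw [ed_comm] at h6
    have := ed_triangle hΓ (ev u c₀) (ev v c₀) (ev w b₀)
    rw [← h4] at h6
    omega
  obtain ⟨U, hU, W, hW, u, c, w, b, hu, hw, h⟩ := hM
  by_cases h1 : W ⊆ U
  · by_cases h2 : U ⊆ W
    · obtain rfl := h1.antisymm h2
      obtain ⟨rfl, h3⟩ := hw.unique hu
      rw [ev_congr_lk h3] at h
      simp at h
    · have := key hU hW hu hw ⟨h1, h2⟩
      omega
  · by_cases h2 : U ⊆ W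
    · have := key hW hU hw hu ⟨h2, h1⟩
      rw [ed_comm] at this
      omega
    · have := ed_le_one_of_incomparable hu hw (Window.mem_sep hE hU) (Window.mem_sep hE hW) h2 h1
      omega

theorem exists_mul_of_mem_par {A B T : Set V} (hT : T ⊆ A ∪ B)
    (hAB : ∀ a ∈ A, ∀ b ∈ B, Γ.Adj a b) {z : Raag Γ} (hz : z ∈ par Γ T) :
    ∃ β ∈ par Γ B, ∃ α ∈ par Γ A, z = β * α := by
  have comm : ∀ α ∈ par Γ A, ∀ β ∈ par Γ B, Commute α β := fun α hα β hβ =>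
    commute_of_mem_par (fun b hb => (commute_of_mem_par (fun a ha =>
      (commute_gen (hAB a ha b hb)).symm) hα).symm) hβ
  induction hz using Subgroup.closure_induction with
  | mem x hx =>
    obtain ⟨u, hu, rfl⟩ := hx
    rcases hT hu with h | h
    · exact ⟨1, one_mem _, _, gen_mem_par h, (one_mul _).symm⟩
    · exact ⟨_, gen_mem_par h, 1, one_mem _, (mul_one _).symm⟩
  | one => exact ⟨1, one_mem _, 1, one_mem _, (mul_one _).symm⟩
  | mul x y _ _ hx hy =>
    obtain ⟨β, hβ, α, hα, rfl⟩ := hx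
    obtain ⟨β', hβ', α', hα', rfl⟩ := hy
    exact ⟨β * β', mul_mem hβ hβ', α * α', mul_mem hα hα', (comm α hα β' hβ').mul_mul_mul_comm β α'⟩
  | inv x _ hx =>
    obtain ⟨β, hβ, α, hα, rfl⟩ := hx
    refine ⟨β⁻¹, inv_mem hβ, α⁻¹, inv_mem hα, ?_⟩
    rw [mul_inv_rev, (comm _ (inv_mem hα) _ (inv_mem hβ)).eq]

/-- The labels of a window with a far pair are connected in the complement graph. -/
theorem FarPair.labels_subset (hΓ : Γ.Connected) {E : Set (Raag Γ)} (hE : 1 ∈ E)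
    {p q : Raag Γ} (hM : FarPair (Window E p q)) {S : Set V}
    (h0 : ∃ t ∈ labels (Window E p q), t ∈ S)
    (h1 : ∀ s ∈ S, s ∈ labels (Window E p q) → ∀ t ∈ labels (Window E p q), s ≠ t → ¬ Γ.Adj s t →
      t ∈ S) : labels (Window E p q) ⊆ S := by
  by_contra hc
  obtain ⟨t₁, ht₁, ht₁S⟩ := Set.not_subset.1 hc
  obtain ⟨t₀, ht₀, ht₀S⟩ := h0
  -- If the labels formed a join of `A` and `B`, a bridge would split as `β * α`. The factor `β`
  -- commutes with `u` and `α` with `w`, so the two walls have adjacent vertices.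
  have nested : ∀ {A B : Set V}, labels (Window E p q) ⊆ A ∪ B → (∀ a ∈ A, ∀ b ∈ B, Γ.Adj a b) →
      ∀ {u w : V} {c b : Raag Γ} {U W : Set (Raag Γ)}, U ∈ Window E p q → W ∈ Window E p q →
      IsHalf u c U → IsHalf w b W → u ∈ A → w ∈ B → W ⊂ U → ed (ev u c) (ev w b) ≤ 1 := by
    intro A B hT hAB u w c b U W hU hW hu hw huA hwB h
    obtain ⟨c₀, b₀, h2, h3, h4⟩ := Window.exists_bridge hU hW hu hw h
    obtain ⟨β, hβ, α, hα, h5⟩ := exists_mul_of_mem_par hT hAB h4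
    have h6 : ev u c₀ = ev u (c₀ * β) := ev_congr_lk (par_mono (fun b hb => hAB u huA b hb) (by
      rwa [inv_mul_cancel_left]))
    have h7 : ev w b₀ = ev w (c₀ * β) := ev_congr_lk (par_mono (fun a ha => (hAB a ha w hwB).symm)
      (by rw [show b₀⁻¹ * (c₀ * β) = (c₀⁻¹ * b₀)⁻¹ * β by group, h5,
            show (β * α)⁻¹ * β = α⁻¹ by group]; exact inv_mem hα))
    rw [ev_congr_lk h2, ev_congr_lk h3, h6, h7]
    exact ed_star (Or.inr (hAB u huA w hwB).symm) _
  have hadj : ∀ a ∈ labels (Window E p q) ∩ S, ∀ b ∈ labels (Window E p q) \ S, Γ.Adj a b := by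
    intro a ha b hb
    by_contra h
    exact hb.2 (h1 a ha.2 ha.1 b hb.1 (fun e => hb.2 (e ▸ ha.2)) h)
  have hcov : labels (Window E p q) ⊆ labels (Window E p q) ∩ S ∪ labels (Window E p q) \ S := by
    rw [Set.inter_union_sdiff]
  have close : ∀ {u w : V} {c b : Raag Γ} {U W : Set (Raag Γ)}, U ∈ Window E p q →
      W ∈ Window E p q → IsHalf u c U → IsHalf w b W → u ∈ S → w ∉ S →
      ed (ev u c) (ev w b) ≤ 1 := by
    intro u w c b U W hU hW hu hw huS hwS
    by_cases h2 : W ⊆ U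
    · refine nested hcov hadj hU hW hu hw ⟨⟨U, hU, c, hu⟩, huS⟩ ⟨⟨W, hW, b, hw⟩, hwS⟩ ⟨h2, fun h3 => ?_⟩
      obtain rfl := h2.antisymm h3
      exact hwS ((hu.unique hw).1 ▸ huS)
    · by_cases h3 : U ⊆ W
      · rw [ed_comm]
        exact nested (by rwa [Set.union_comm]) (fun a ha b hb => (hadj b hb a ha).symm) hW hU hw hu
          ⟨⟨W, hW, b, hw⟩, hwS⟩ ⟨⟨U, hU, c, hu⟩, huS⟩ ⟨h3, h2⟩
      · exact ed_le_one_of_incomparable hu hw (Window.mem_sep hE hU) (Window.mem_sep hE hW) h3 h2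
  obtain ⟨H₀, hH₀, g₀, hg₀⟩ := ht₀
  obtain ⟨H₁, hH₁, g₁, hg₁⟩ := ht₁
  obtain ⟨U, hU, W, hW, u, c, w, b, hu, hw, h⟩ := hM
  -- Two walls on opposite sides of the join are within 1; two on the same side are within 2,
  -- through a wall of the other side.
  by_cases huS : u ∈ S <;> by_cases hwS : w ∈ S
  · have a1 := close hU hH₁ hu hg₁ huS ht₁S
    have a2 := close hW hH₁ hw hg₁ hwS ht₁S
    rw [ed_comm] at a2
    have := ed_triangle hΓ (ev u c) (ev t₁ g₁) (ev w b)
    omega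
  · have := close hU hW hu hw huS hwS
    omega
  · have := close hW hU hw hu hwS huS
    rw [ed_comm] at this
    omega
  · have a1 := close hH₀ hU hg₀ hu ht₀S huS
    have a2 := close hH₀ hW hg₀ hw ht₀S hwS
    rw [ed_comm] at a1
    have := ed_triangle hΓ (ev u c) (ev t₀ g₀) (ev w b)
    omega

/-- Half-spaces of the window with equal or non-adjacent labels are nested, and the labels are
connected in the complement graph, so a property inherited through nesting reaches all of them. -/
theorem FarPair.propagate (hΓ : Γ.Connected) {E : Set (Raag Γ)} (hE : 1 ∈ E)
    {p q : Raag Γ} (hM : FarPair (Window E p q)) {P : Set (Raag Γ) → Prop}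
    (hP : ∀ U ∈ Window E p q, ∀ W ∈ Window E p q, (U ⊆ W ∨ W ⊆ U) → P U → P W)
    {U₀ : Set (Raag Γ)} (hU₀ : U₀ ∈ Window E p q) (h0 : P U₀) : ∀ W ∈ Window E p q, P W := by
  have cmp : ∀ {s t : V} {U W : Set (Raag Γ)}, U ∈ Window E p q → W ∈ Window E p q →
      HasLabel s U → HasLabel t W → ¬ Γ.Adj s t → (U ⊆ W ∨ W ⊆ U) := fun hU hW hs ht h =>
    comparable_of_sep hs ht (Window.mem_sep hE hU) (Window.mem_sep hE hW) h
  obtain ⟨t₀, ht₀⟩ := hU₀.1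
  have := hM.labels_subset hΓ hE (S := {t | ∀ H ∈ Window E p q, HasLabel t H → P H})
    ⟨t₀, ⟨U₀, hU₀, ht₀⟩, fun H hH ht => hP _ hU₀ _ hH (cmp hU₀ hH ht₀ ht fun h => h.ne rfl) h0⟩
    (by
      rintro s hs ⟨U, hU, hsU⟩ t - - hst H hH ht
      exact hP U hU H hH (cmp hU hH hsU ht hst) (hs U hU hsU))
  intro W hW
  obtain ⟨t, ht⟩ := hW.1
  exact this ⟨W, hW, ht⟩ W hW ht

section Sign

/-- Otherwise `W` would lie in every `h ^ n • U`, and these have empty intersection. -/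
theorem not_subset_smul {u w : V} {h : Raag Γ} {U W : Set (Raag Γ)} (hu : HasLabel u U)
    (hw : HasLabel w W) (hWU : W ⊆ U) (hU : h • U ⊂ U) : ¬ W ⊆ h • W := by
  intro hW
  obtain ⟨x, hx⟩ := hw.exists_mem
  obtain ⟨n, hn⟩ := exists_notMem_zpow_smul hu hU x
  have key : ∀ n : ℕ, W ⊆ h ^ (n : ℤ) • W := by
    intro n
    induction n with
    | zero => simp
    | succ n ih =>
      push_cast
      rw [zpow_add_one, mul_smul]
      exact ih.trans (Set.smul_set_mono hW)
  exact hn (Set.smul_set_mono hWU (key n hx))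

theorem smul_ssubset_of_comparable {u w : V} {z : Raag Γ} {U W : Set (Raag Γ)} (hu : HasLabel u U)
    (hw : HasLabel w W) (hUW : U ⊆ W ∨ W ⊆ U) (hW : z • W ⊆ W ∨ W ⊆ z • W) (h : z • U ⊂ U) :
    z • W ⊂ W := by
  by_contra hc
  have h1 : W ⊆ z • W := by
    rcases hW with hW | hW
    · by_contra h'; exact hc ⟨hW, h'⟩
    · exact hW
  rcases hUW with h2 | h2
  · refine not_subset_smul hu.compl hw.compl (Set.compl_subset_compl.2 h2)
      (smul_compl_ssubset h) ?_
    rw [Set.smul_set_compl, Set.compl_subset_compl]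
    have := Set.smul_set_mono (a := z⁻¹) h1
    rwa [inv_smul_smul] at this
  · exact not_subset_smul hu hw h2 h h1

theorem smul_eq_of_comparable {u w : V} {z : Raag Γ} {U W : Set (Raag Γ)} (hu : HasLabel u U)
    (hw : HasLabel w W) (hUW : U ⊆ W ∨ W ⊆ U) (hW : z • W ⊆ W ∨ W ⊆ z • W) (h : z • U = U) :
    z • W = W := by
  by_contra hc
  rcases hW with h1 | h1
  · exact (smul_ssubset_of_comparable hw hu hUW.symm (Or.inl h.le)
      (Set.ssubset_iff_subset_ne.2 ⟨h1, hc⟩)).ne h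
  · have h3 : z⁻¹ • W ⊂ W := by
      have := smul_ssubset_smul_iff (a := z⁻¹).2 (Set.ssubset_iff_subset_ne.2 ⟨h1, fun e => hc e.symm⟩)
      rwa [inv_smul_smul] at this
    have h4 : z⁻¹ • U = U := by rw [inv_smul_eq_iff, h]
    exact (smul_ssubset_of_comparable hw hu hUW.symm (Or.inl h4.le) h3).ne h4

end Sign

/-- By propagation `z` fixes both half-spaces of the far pair. If `z ≠ 1`, a wall crossing both
brings their vertices within distance 2. -/
theorem FarPair.eq_one (hΓ : Γ.Connected) {E : Set (Raag Γ)} (hE : 1 ∈ E)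
    {p q z : Raag Γ} (hM : FarPair (Window E p q))
    (hz : ∀ U ∈ Window E p q, z • U ⊆ U ∨ U ⊆ z • U)
    {U₀ : Set (Raag Γ)} (hU₀ : U₀ ∈ Window E p q) (h0 : z • U₀ = U₀) : z = 1 := by
  have h1 := hM.propagate hΓ hE (P := fun U => z • U = U) (fun _ hU W hW h h' =>
    smul_eq_of_comparable hU.1.choose_spec hW.1.choose_spec h (hz W hW) h') hU₀ h0
  obtain ⟨U, hU, W, hW, u, c, w, b, hu, hw, h⟩ := hM
  refine (eq_one_or_exists_of_smul_eq hu hw (h1 U hU) (h1 W hW)).resolve_right ?_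
  rintro ⟨t, c', b', h2, h3, h4, h5, h6⟩
  rw [ev_congr_lk h2, ev_congr_lk h3] at h
  have a1 := ed_star (Γ := Γ) (u := u) (v := t) (Or.inr h4.symm) c'
  have a2 := ed_star (Γ := Γ) (u := t) (v := w) (Or.inr h5) b'
  rw [ev_congr_lk h6] at a1
  have := ed_triangle hΓ (ev u c') (ev t b') (ev w b')
  omega

theorem FarPair.smul_ssubset (hΓ : Γ.Connected) {E : Set (Raag Γ)} (hE : 1 ∈ E)
    {p q z : Raag Γ} (hM : FarPair (Window E p q))
    (hz : ∀ U ∈ Window E p q, z • U ⊆ U ∨ U ⊆ z • U)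
    {U₀ : Set (Raag Γ)} (hU₀ : U₀ ∈ Window E p q) (h0 : z • U₀ ⊂ U₀) :
    ∀ W ∈ Window E p q, z • W ⊂ W :=
  hM.propagate hΓ hE (P := fun U => z • U ⊂ U) (fun _ hU W hW h h' =>
    smul_ssubset_of_comparable hU.1.choose_spec hW.1.choose_spec h (hz W hW) h') hU₀ h0

theorem Window.comparable {E : Set (Raag Γ)} (hE : 1 ∈ E) {p q z : Raag Γ} (hz : z⁻¹ ∈ E)
    {U : Set (Raag Γ)} (hU : U ∈ Window E p q) : z • U ⊆ U ∨ U ⊆ z • U := by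
  obtain ⟨v, hv⟩ := hU.1
  exact comparable_of_sep (hv.smul z) hv (Window.smul_mem_sep hU hz) (Window.mem_sep hE hU) fun h => h.ne rfl

/-! ### Existence of far pairs -/

section Existence

variable [Finite V]

/-- A discrete intermediate value argument: at the step of a geodesic from `p` to `q` that leaves
the region within `A` of `x`, the vertex of the crossed wall is beyond `A`, but it shares a copy of
`Γ` with a vertex within `A`, whence the error `Γ.diam`. -/
theorem exists_sep_dist (hΓ : Γ.Connected) (x : ExtensionVertex Γ) {A : ℕ} {q : Raag Γ} {w : V}
    (hA : A + Γ.diam < ed x (ev w q)) {v : V} {p : Raag Γ} (hp : ed x (ev v p) ≤ A) :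
    ∃ U ∈ Sep p q, ∃ u c, IsHalf u c U ∧ A < ed x (ev u c) ∧ ed x (ev u c) ≤ A + Γ.diam := by
  have hg := geo q p
  induction hg generalizing v with
  | refl =>
    have := ed_triangle hΓ x (ev v q) (ev w q)
    have := ed_ev_le_diam hΓ v w q
    omega
  | @step u p p' H hn hH hp' _ ih =>
    by_cases h : ∃ v', ed x (ev v' p') ≤ A
    · obtain ⟨v', hv'⟩ := h
      obtain ⟨U, hU, h1⟩ := ih hv'
      exact ⟨U, (Sep.of_step hn hH hp' hU).1, h1⟩
    · push Not at h
      obtain ⟨⟨k, d, h1⟩, h2, h3⟩ := id hH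
      obtain ⟨rfl, h4, -⟩ := h1.carrier_of_nb hn fun h => h2 (h.2 hp')
      refine ⟨H, hH, u, d, h1, ?_⟩
      rw [ev_congr h4.mem_star]
      refine ⟨hn.ev_eq ▸ h u, ?_⟩
      have := ed_triangle hΓ x (ev v p) (ev u p)
      have := ed_ev_le_diam hΓ v u p
      omega

theorem farPair_window (hΓ : Γ.Connected) {E : Set (Raag Γ)} {p q : Raag Γ} {v w : V} {ρ : ℕ}
    (hp : ∀ e ∈ E, ed (ev v p) (ev v (e * p)) ≤ ρ) (hq : ∀ e ∈ E, ed (ev w q) (ev w (e * q)) ≤ ρ)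
    (hd : 2 * ρ + 2 * Γ.diam + 4 < ed (ev v p) (ev w q)) : FarPair (Window E p q) := by
  -- A wall separating `p` from `e * p` is within `ρ + 1` of the first vertex, and one separating
  -- `q` from `e * q` is within `ρ + 1` of the second. Distances from the first vertex in the stated
  -- range exclude both.
  have mem : ∀ {U u c}, U ∈ Sep p q → IsHalf u c U → ρ + 1 < ed (ev v p) (ev u c) →
      ed (ev v p) (ev u c) ≤ ρ + 3 + 2 * Γ.diam → U ∈ Window E p q := by
    intro U u c hU hu h1 h2
    refine ⟨⟨u, c, hu⟩, fun e he => ⟨fun h => ?_, ?_⟩⟩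
    · have h3 := ed_le_of_separates hΓ (v := v) (w := v) hu (fun h' => hU.2.1 (h'.2 h))
      have h4 := hp e he
      rw [ed_comm] at h3
      omega
    · by_contra h
      have h3 := ed_le_of_separates hΓ (v := w) (w := w) hu (fun h' => h (h'.1 hU.2.2))
      have h4 := hq e he
      have := ed_triangle hΓ (ev v p) (ev u c) (ev w q)
      omega
  have h0 : ed (ev v p) (ev v p) = 0 := SimpleGraph.dist_self
  -- The thresholds `ρ + 1` and `ρ + 3 + Γ.diam` leave a gap of at least 3 between the two walls,
  -- each being located up to `Γ.diam`.
  obtain ⟨U, hU, u, c, hu, h1, h2⟩ := exists_sep_dist hΓ (ev v p) (A := ρ + 1) (q := q) (w := w)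
    (by omega) (v := v) (p := p) (by omega)
  obtain ⟨W, hW, w', b, hw, h3, h4⟩ := exists_sep_dist hΓ (ev v p) (A := ρ + 3 + Γ.diam) (q := q)
    (w := w) (by omega) (v := v) (p := p) (by omega)
  refine ⟨U, mem hU hu h1 (by omega), W, mem hW hw (by omega) (by omega), u, c, w', b, hu, hw, ?_⟩
  have := ed_triangle hΓ (ev v p) (ev u c) (ev w' b)
  omega

end Existence

/-! ### Counting walls: commutation and cyclic centralizers -/

/-- The half-spaces of label `v` between `B` and `A`, including `B` but not `A`. -/
def between (v : V) (A B : Set (Raag Γ)) : Set (Set (Raag Γ)) :=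
  {K | HasLabel v K ∧ B ⊆ K ∧ K ⊂ A}

theorem finite_between {v : V} {A B : Set (Raag Γ)} (hA : HasLabel v A) (hB : HasLabel v B) :
    (between v A B).Finite := by
  obtain ⟨a, ha⟩ := hA.exists_notMem
  obtain ⟨b, hb⟩ := hB.exists_mem
  exact (finite_sep a b).subset fun K hK => ⟨⟨v, hK.1⟩, fun h => ha (hK.2.2.1 h), hK.2.1 hb⟩

theorem ncard_between_add {v : V} {A B C : Set (Raag Γ)} (hA : HasLabel v A) (hB : HasLabel v B)
    (hC : HasLabel v C) (h1 : B ⊆ A) (h2 : C ⊆ B) :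
    (between v A C).ncard = (between v A B).ncard + (between v B C).ncard := by
  rw [← Set.ncard_union_eq _ (finite_between hA hB) (finite_between hB hC)]
  · congr 1
    ext K
    constructor
    · rintro ⟨hK, h3, h4⟩
      obtain ⟨a, ha⟩ := hA.exists_notMem
      obtain ⟨c, hc⟩ := hC.exists_mem
      have h5 : K ⊆ B ∨ B ⊆ K := comparable_of_sep hK hB
        (p := a) (q := c) ⟨⟨v, hK⟩, fun h => ha (h4.1 h), h3 hc⟩ ⟨⟨v, hB⟩, fun h => ha (h1 h), h2 hc⟩
        fun h => h.ne rfl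
      by_cases h6 : B ⊆ K
      · exact Or.inl ⟨hK, h6, h4⟩
      · exact Or.inr ⟨hK, h3, h5.resolve_right h6, h6⟩
    · rintro (⟨hK, h3, h4⟩ | ⟨hK, h3, h4⟩)
      · exact ⟨hK, h2.trans h3, h4⟩
      · exact ⟨hK, h3, lt_of_lt_of_le h4 h1⟩
  · exact Set.disjoint_left.2 fun K h3 h4 => h4.2.2.2 h3.2.1

theorem ncard_between_pos {v : V} {A B : Set (Raag Γ)} (hA : HasLabel v A) (hB : HasLabel v B)
    (h : B ⊂ A) : 0 < (between v A B).ncard :=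
  (Set.ncard_pos (finite_between hA hB)).2 ⟨B, hB, subset_rfl, h⟩

theorem ncard_between_smul (k : Raag Γ) (v : V) (A B : Set (Raag Γ)) :
    (between v (k • A) (k • B)).ncard = (between v A B).ncard := by
  have : between v (k • A) (k • B) = (fun K : Set (Raag Γ) => k • K) '' between v A B := by
    ext K
    constructor
    · rintro ⟨h1, h2, h3⟩
      refine ⟨k⁻¹ • K, ⟨h1.smul _, ?_, ?_⟩, smul_inv_smul k K⟩
      · rwa [← Set.smul_set_subset_smul_set_iff (a := k), smul_inv_smul]
      · rwa [← smul_ssubset_smul_iff (a := k), smul_inv_smul]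
    · rintro ⟨K, ⟨h1, h2, h3⟩, rfl⟩
      exact ⟨h1.smul k, Set.smul_set_mono h2, smul_ssubset_smul_iff.2 h3⟩
  rw [this, Set.ncard_image_of_injective _ (MulAction.injective k)]

/-- For `g` and `h` both shrinking `W`, the nested half-spaces `(g * h) • W` and `(h * g) • W` have
the same number of walls of label `v` between them and `W`, hence coincide. The commutator fixes `W`
and, being a product of four elements of `X`, is trivial. Inverses reduce the other cases to this
one. -/
theorem commute_of_window (hΓ : Γ.Connected) {E X : Set (Raag Γ)} {p q : Raag Γ}
    (hM : FarPair (Window E p q)) (hX1 : 1 ∈ X) (hXinv : ∀ a ∈ X, a⁻¹ ∈ X)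
    (hX : ∀ a ∈ X, ∀ b ∈ X, ∀ c ∈ X, ∀ d ∈ X, a * b * c * d ∈ E) {g h : Raag Γ} (hg : g ∈ X)
    (hh : h ∈ X) : Commute g h := by
  have hE : (1 : Raag Γ) ∈ E := by simpa using hX 1 hX1 1 hX1 1 hX1 1 hX1
  have hXE : ∀ a ∈ X, a ∈ E := fun a ha => by simpa using hX a ha 1 hX1 1 hX1 1 hX1
  obtain ⟨W, hW⟩ : ∃ W, W ∈ Window E p q := by obtain ⟨U, hU, -⟩ := hM; exact ⟨U, hU⟩
  obtain ⟨v, hv⟩ := id hW.1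
  have key : ∀ g ∈ X, ∀ h ∈ X, g • W ⊂ W → h • W ⊂ W → Commute g h := by
    intro g hg h hh hgW hhW
    have cnt : ∀ {g h : Raag Γ}, g • W ⊂ W → h • W ⊂ W → (between v W ((g * h) • W)).ncard =
        (between v W (g • W)).ncard + (between v W (h • W)).ncard := by
      intro g h hgW hhW
      rw [ncard_between_add hv (hv.smul g) (hv.smul _) hgW.1
        (by rw [mul_smul]; exact Set.smul_set_mono hhW.1), mul_smul, ncard_between_smul]
    have strict : ∀ {g h : Raag Γ}, g • W ⊂ W → h • W ⊂ W → ¬ (g * h) • W ⊂ (h * g) • W := by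
      intro g h hgW hhW hc
      have h1 := ncard_between_add hv (hv.smul (h * g)) (hv.smul (g * h))
        (by rw [mul_smul]; exact (Set.smul_set_mono hgW.1).trans hhW.1) hc.1
      have h2 := ncard_between_pos (hv.smul _) (hv.smul _) hc
      have h3 := cnt hgW hhW
      have h4 := cnt hhW hgW
      omega
    have hin : ∀ g ∈ X, ∀ h ∈ X, (g * h) • W ∈ Sep p q := fun g hg h hh =>
      Window.smul_mem_sep hW (by
        simpa using hX _ (hXinv h hh) _ (hXinv g hg) 1 hX1 1 hX1)
    have heq : (g * h) • W = (h * g) • W := by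
      by_contra hne
      rcases comparable_of_sep (hv.smul _) (hv.smul _) (hin g hg h hh) (hin h hh g hg)
        fun h => h.ne rfl with h1 | h1
      · exact strict hgW hhW (Set.ssubset_iff_subset_ne.2 ⟨h1, hne⟩)
      · exact strict hhW hgW (Set.ssubset_iff_subset_ne.2 ⟨h1, fun e => hne e.symm⟩)
    have h1 : (h * g)⁻¹ * (g * h) = 1 := by
      refine hM.eq_one hΓ hE (fun U hU => Window.comparable hE ?_ hU) hW ?_
      · have := hX _ (hXinv h hh) _ (hXinv g hg) _ hh _ hg
        rwa [show ((h * g)⁻¹ * (g * h))⁻¹ = h⁻¹ * g⁻¹ * h * g by group]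
      · rw [mul_smul, heq, inv_smul_smul]
    exact (inv_mul_eq_one.1 h1).symm
  have sign : ∀ g ∈ X, g = 1 ∨ g • W ⊂ W ∨ g⁻¹ • W ⊂ W := by
    intro g hg
    by_cases h1 : g • W = W
    · exact Or.inl (hM.eq_one hΓ hE
        (fun U hU => Window.comparable hE (hXE _ (hXinv g hg)) hU) hW h1)
    · right
      rcases Window.comparable hE (hXE _ (hXinv g hg)) hW with h2 | h2
      · exact Or.inl (Set.ssubset_iff_subset_ne.2 ⟨h2, h1⟩)
      · right
        have := smul_ssubset_smul_iff (a := g⁻¹).2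
          (Set.ssubset_iff_subset_ne.2 ⟨h2, fun e => h1 e.symm⟩)
        rwa [inv_smul_smul] at this
  rcases sign g hg with rfl | h1 | h1
  · exact Commute.one_left h
  · rcases sign h hh with rfl | h2 | h2
    · exact Commute.one_right g
    · exact key g hg h hh h1 h2
    · exact Commute.inv_right_iff.1 (key g hg _ (hXinv h hh) h1 h2)
  · rcases sign h hh with rfl | h2 | h2
    · exact Commute.one_right g
    · exact Commute.inv_left_iff.1 (key _ (hXinv g hg) h hh h1 h2)
    · exact Commute.inv_inv_iff.1 (key _ (hXinv g hg) _ (hXinv h hh) h1 h2)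

/-- The centralizer of an element translating a window is cyclic. -/
theorem exists_generator (hΓ : Γ.Connected) {E : Set (Raag Γ)} (hE : 1 ∈ E) {p q h : Raag Γ}
    (hM : FarPair (Window E p q)) (hh : ∀ U ∈ Window E p q, h • U ⊂ U) :
    ∃ g, Commute h g ∧ (∀ U ∈ Window E p q, g • U ⊂ U) ∧
      ∀ z, Commute h z → ∃ m : ℤ, z = g ^ m := by
  obtain ⟨W, hW⟩ : ∃ W, W ∈ Window E p q := by obtain ⟨U, hU, -⟩ := hM; exact ⟨U, hU⟩
  obtain ⟨v, hv⟩ := id hW.1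
  have axis : ∀ z, Commute h z → ∀ U ∈ Window E p q, h • z • U ⊂ z • U := by
    intro z hz U hU
    rw [smul_smul, hz.eq, mul_smul]
    exact smul_ssubset_smul_iff.2 (hh U hU)
  have cmp : ∀ z, Commute h z → ∀ U ∈ Window E p q, z • U ⊆ U ∨ U ⊆ z • U := by
    intro z hz U hU
    obtain ⟨u, hu⟩ := hU.1
    exact comparable_of_axis (hu.smul z) hu (axis z hz U hU) (hh U hU) fun h => h.ne rfl
  -- The generator is an element of the centralizer with the shortest positive translation of `W`;
  -- `main` divides by it repeatedly.
  obtain ⟨g, ⟨hg, hgW⟩, hmin⟩ := WellFounded.has_min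
    (measure fun z : Raag Γ => (between v W (z • W)).ncard).wf {z | Commute h z ∧ z • W ⊂ W}
    ⟨h, Commute.refl h, hh W hW⟩
  have main : ∀ n z, Commute h z → z • W ⊆ W → (between v W (z • W)).ncard ≤ n →
      ∃ m : ℤ, z = g ^ m := by
    intro n
    induction n with
    | zero =>
      intro z hz hzW hn
      refine ⟨0, ?_⟩
      rw [zpow_zero]
      refine hM.eq_one hΓ hE (cmp z hz) hW ?_
      by_contra hne
      have := ncard_between_pos hv (hv.smul z) (Set.ssubset_iff_subset_ne.2 ⟨hzW, hne⟩)
      omega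
    | succ n ih =>
      intro z hz hzW hn
      by_cases hne : z • W = W
      · exact ⟨0, by rw [zpow_zero]; exact hM.eq_one hΓ hE (cmp z hz) hW hne⟩
      have h1 : ¬ (between v W (z • W)).ncard < (between v W (g • W)).ncard :=
        hmin z ⟨hz, Set.ssubset_iff_subset_ne.2 ⟨hzW, hne⟩⟩
      have h2 : z • W ⊆ g • W := by
        by_contra h2
        have h3 : g • W ⊆ z • W := (comparable_of_axis (hv.smul z) (hv.smul g) (axis z hz W hW)
          (axis g hg W hW) fun h => h.ne rfl).resolve_left h2
        have h4 := ncard_between_add hv (hv.smul z) (hv.smul g) hzW h3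
        have h5 := ncard_between_pos (hv.smul z) (hv.smul g) ⟨h3, h2⟩
        omega
      have h3 := ncard_between_add hv (hv.smul g) (hv.smul z) hgW.1 h2
      have h4 := ncard_between_pos hv (hv.smul g) hgW
      have h5 : (g⁻¹ * z) • W ⊆ W := by
        rw [mul_smul, ← Set.smul_set_subset_smul_set_iff (a := g), smul_inv_smul]; exact h2
      have h6 := ncard_between_smul g v W ((g⁻¹ * z) • W)
      rw [smul_smul, mul_inv_cancel_left] at h6
      obtain ⟨m, hm⟩ := ih (g⁻¹ * z) (hg.inv_right.mul_right hz) h5 (by omega)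
      exact ⟨1 + m, by rw [zpow_one_add, ← hm, mul_inv_cancel_left]⟩
  refine ⟨g, hg, hM.smul_ssubset hΓ hE (cmp g hg) hW hgW, fun z hz => ?_⟩
  rcases cmp z hz W hW with h1 | h1
  · exact main _ z hz h1 le_rfl
  · obtain ⟨m, hm⟩ := main _ z⁻¹ hz.inv_right (by
      rw [← Set.smul_set_subset_smul_set_iff (a := z), smul_inv_smul]; exact h1) le_rfl
    exact ⟨-m, by rw [zpow_neg, ← hm, inv_inv]⟩

/-! ### The potential and the displacement bound -/

/-- The largest value of `f` on the vertices of `T` outside the star of `v`. -/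
noncomputable def maxOff (Γ : SimpleGraph V) (T : Set V) (f : V → ℤ) (v : V) : ℤ :=
  sSup (f '' (T \ star Γ v))

/-- The complement graph restricted to `T`. -/
def offGraph (Γ : SimpleGraph V) (T : Set V) : SimpleGraph V where
  Adj s t := s ∈ T ∧ t ∈ T ∧ s ≠ t ∧ ¬ Γ.Adj s t
  symm := ⟨fun _ _ h => ⟨h.2.1, h.1, h.2.2.1.symm, fun h' => h.2.2.2 h'.symm⟩⟩
  loopless := ⟨fun _ h => h.2.2.1 rfl⟩

section MaxOff

variable {T : Set V}

theorem exists_maxOff [Finite V] (hT : ∀ v, ∃ t ∈ T, t ∉ star Γ v) (f : V → ℤ) (v : V) :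
    ∃ t ∈ T, t ∉ star Γ v ∧ f t = maxOff Γ T f v := by
  have hne : (f '' (T \ star Γ v)).Nonempty := by
    obtain ⟨t, h1, h2⟩ := hT v; exact ⟨f t, t, ⟨h1, h2⟩, rfl⟩
  obtain ⟨t, ⟨h1, h2⟩, h3⟩ := hne.csSup_mem (Set.toFinite _)
  exact ⟨t, h1, h2, h3⟩

theorem le_maxOff [Finite V] (f : V → ℤ) {v t : V} (h1 : t ∈ T) (h2 : t ∉ star Γ v) :
    f t ≤ maxOff Γ T f v :=
  le_csSup (Set.toFinite _).bddAbove ⟨t, ⟨h1, h2⟩, rfl⟩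

theorem maxOff_congr {f f' : V → ℤ} {v : V} (h : ∀ t ∈ T, t ∉ star Γ v → f t = f' t) :
    maxOff Γ T f v = maxOff Γ T f' v := by
  unfold maxOff
  rw [Set.image_congr fun t ht => h t ht.1 ht.2]

theorem maxOff_add [Finite V] (hT : ∀ v, ∃ t ∈ T, t ∉ star Γ v) {f f' : V → ℤ} {m : ℤ}
    (h : ∀ t ∈ T, f' t = f t + m) (v : V) : maxOff Γ T f' v = maxOff Γ T f v + m := by
  obtain ⟨t, h1, h2, h3⟩ := exists_maxOff hT f v
  obtain ⟨t', h1', h2', h3'⟩ := exists_maxOff hT f' v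
  have := le_maxOff f h1' h2'
  have := le_maxOff f' h1 h2
  have := h t h1
  have := h t' h1'
  omega

theorem sub_le_walk_length {f : V → ℤ} (hf : ∀ s ∈ T, ∀ t ∈ T, s ≠ t → ¬ Γ.Adj s t → f s ≤ f t + 1)
    {s t : V} (p : (offGraph Γ T).Walk s t) : f s ≤ f t + p.length := by
  induction p with
  | nil => simp
  | cons h p ih =>
    have := hf _ h.1 _ h.2.1 h.2.2.1 h.2.2.2
    rw [SimpleGraph.Walk.length_cons]
    push_cast
    omega

theorem mem_of_mem_support {s t x : V} (p : (offGraph Γ T).Walk s t) (hs : s ∈ T)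
    (hx : x ∈ p.support) : x ∈ T := by
  induction p with
  | nil => simp at hx; exact hx ▸ hs
  | cons h p ih =>
    rw [SimpleGraph.Walk.support_cons, List.mem_cons] at hx
    rcases hx with rfl | hx
    · exact hs
    · exact ih h.2.1 hx

/-- Moving along an edge of `Γ` increases the potential by at most `|V| - 2`; in the case of
equality the two endpoints have different valences in the complement graph. -/
theorem maxOff_le [Fintype V] (hT : ∀ v, ∃ t ∈ T, t ∉ star Γ v)
    (hconn : ∀ s ∈ T, ∀ t ∈ T, (offGraph Γ T).Reachable s t) {f : V → ℤ}
    (hf : ∀ s ∈ T, ∀ t ∈ T, s ≠ t → ¬ Γ.Adj s t → f s ≤ f t + 1) {v w : V} (hvw : Γ.Adj v w) :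
    maxOff Γ T f w ≤ maxOff Γ T f v + (Fintype.card V - 2) ∧
    (maxOff Γ T f v + (Fintype.card V - 2) ≤ maxOff Γ T f w →
      (star Γ v)ᶜ.ncard ≤ 1 ∧ 2 ≤ (star Γ w)ᶜ.ncard) := by
  classical
  obtain ⟨t, ht, htw, hmax⟩ := exists_maxOff hT f w
  -- A shortest path in the complement graph from a maximizer off the star of `w` to the complement
  -- of the star of `v`. Only its last vertex is off the star of `v`.
  obtain ⟨t', ⟨ht', ht'v⟩, hmin⟩ := Set.exists_min_image (T \ star Γ v) (fun s => (offGraph Γ T).dist t s)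
    (Set.toFinite _) (by obtain ⟨s, h1, h2⟩ := hT v; exact ⟨s, h1, h2⟩)
  obtain ⟨p, hp⟩ := (hconn t ht t' ht').exists_walk_length_eq_dist
  have hpath : p.IsPath := p.isPath_of_length_eq_dist hp
  have hmem : ∀ s ∈ p.support, s ∈ T := fun s hs => mem_of_mem_support p ht hs
  have hend : ∀ s ∈ p.support, s ∉ star Γ v → s = t' := by
    intro s hs hsv
    have h1 := hmin s ⟨hmem s hs, hsv⟩
    have h2 := SimpleGraph.dist_le (p.takeUntil s hs)
    have h3 := congrArg SimpleGraph.Walk.length (p.take_spec hs)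
    rw [SimpleGraph.Walk.length_append] at h3
    exact SimpleGraph.Walk.eq_of_length_eq_zero (p := p.dropUntil s hs) (by omega)
  -- The predecessor of `v` on the path would be off the star of `v` and closer to `t`. Avoiding
  -- `v`, the path has at most `|V| - 1` vertices, so its length is at most `|V| - 2`.
  have hv : v ∉ p.support := by
    intro hs
    have h2 : ¬ (p.takeUntil v hs).Nil := SimpleGraph.Walk.not_nil_of_ne fun h =>
      htw (h ▸ Or.inr hvw.symm)
    have h4 := SimpleGraph.Walk.adj_penultimate h2
    have h5 := hmin (p.takeUntil v hs).penultimate ⟨h4.1, by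
      rintro (h | h)
      · exact h4.2.2.1 h
      · exact h4.2.2.2 h.symm⟩
    have h6 := SimpleGraph.dist_le (p.takeUntil v hs).dropLast
    have h3 := congrArg SimpleGraph.Walk.length (p.take_spec hs)
    have h7 := congrArg SimpleGraph.Walk.length (SimpleGraph.Walk.concat_dropLast (p := p.takeUntil v hs) h4)
    rw [SimpleGraph.Walk.length_append] at h3
    rw [SimpleGraph.Walk.length_concat] at h7
    omega
  have hnd : (v :: p.support).Nodup := List.nodup_cons.2 ⟨hv, hpath.support_nodup⟩
  have hcard := hnd.length_le_card
  rw [List.length_cons, SimpleGraph.Walk.length_support] at hcard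
  have hlen := sub_le_walk_length hf p
  have hle := le_maxOff f ht' ht'v
  refine ⟨by omega, fun heq => ?_⟩
  -- In the case of equality the path visits every vertex but `v`: only `t'` is off the star of `v`,
  -- while `t` and the successor of `w` are both off the star of `w`.
  have hall : ∀ s, s ≠ v → s ∈ p.support := by
    intro s hs
    by_contra hsp
    have h1 : (s :: v :: p.support).Nodup := List.nodup_cons.2
      ⟨by rw [List.mem_cons]; exact fun h => h.elim hs hsp, hnd⟩
    have := h1.length_le_card
    rw [List.length_cons, List.length_cons, SimpleGraph.Walk.length_support] at this
    omega
  constructor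
  · have : (star Γ v)ᶜ ⊆ {t'} := fun s hs => hend s (hall s fun h => hs (Or.inl h)) hs
    exact (Set.ncard_le_ncard this).trans (Set.ncard_singleton _).le
  · have hw : w ∈ p.support := hall w hvw.ne'
    have hwt' : w ≠ t' := fun h => ht'v (h ▸ Or.inr hvw)
    have h3 := congrArg SimpleGraph.Walk.length (p.take_spec hw)
    rw [SimpleGraph.Walk.length_append] at h3
    obtain ⟨s, h, r, hr⟩ := SimpleGraph.Walk.exists_eq_cons_of_ne hwt' (p.dropUntil w hw)
    rw [hr, SimpleGraph.Walk.length_cons] at h3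
    have hst : t ≠ s := by
      rintro rfl
      have := SimpleGraph.dist_le r
      omega
    have : ({t, s} : Set V) ⊆ (star Γ w)ᶜ := by
      rintro x (rfl | rfl)
      · exact htw
      · rintro (h' | h')
        · exact h.2.2.1 h'.symm
        · exact h.2.2.2 h'
    calc 2 = ({t, s} : Set V).ncard := (Set.ncard_pair hst).symm
      _ ≤ _ := Set.ncard_le_ncard this

end MaxOff

/-- A lower bound for the displacement of an element with an axis. -/
theorem lt_card_mul_ed [Fintype V] (hΓ : Γ.Connected) {T : Set V}
    (hT : ∀ v, ∃ t ∈ T, t ∉ star Γ v)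
    (hconn : ∀ s ∈ T, ∀ t ∈ T, (offGraph Γ T).Reachable s t) {g : Raag Γ} {U : V → Set (Raag Γ)}
    (hU : ∀ t ∈ T, HasLabel t (U t)) (hgU : ∀ t ∈ T, g • U t ⊂ U t) (v : V) (a : Raag Γ) {m : ℤ}
    (hm : 0 < m) : m < (Fintype.card V - 2) * (ed (ev v a) (ev v (g ^ m * a)) : ℤ) := by
  -- Positions along the axes, normalized to vanish at `1`: the unknown offset between two
  -- interleaving axes cancels, leaving a difference of at most 1.
  let φ : Raag Γ → V → ℤ := fun b t => idx g (U t) b - idx g (U t) 1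
  have hφ : ∀ b, ∀ s ∈ T, ∀ t ∈ T, s ≠ t → ¬ Γ.Adj s t → φ b s ≤ φ b t + 1 := by
    intro b s hs t ht _ hst
    obtain ⟨k, hk⟩ := exists_idx_sub (hU s hs) (hU t ht) (hgU s hs) (hgU t ht) hst
    have h1 := hk b
    have h2 := hk 1
    simp only [φ]
    omega
  have hstar : ∀ {v b c}, b⁻¹ * c ∈ par Γ (star Γ v) → ∀ t ∈ T, t ∉ star Γ v → φ b t = φ c t := by
    intro v b c h t ht htv
    have := idx_congr (hU t ht) (hgU t ht) (a := b) (b := c) fun H ⟨d, hd⟩ => by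
      by_contra h'
      exact htv (hd.of_par h b (by rwa [mul_inv_cancel_left])).1
    simp only [φ, this]
  choose lab rep hrep using exists_ev (Γ := Γ)
  let F : ExtensionVertex Γ → ℤ := fun x => maxOff Γ T (φ (rep x)) (lab x)
  have hF : ∀ v b, F (ev v b) = maxOff Γ T (φ b) v := by
    intro v b
    obtain ⟨h1, h2⟩ := ev_eq_iff.1 (hrep (ev v b))
    change maxOff Γ T (φ (rep (ev v b))) (lab (ev v b)) = _
    rw [← h1]
    exact maxOff_congr fun t ht htv => (hstar h2 t ht htv).symm
  have hlab : ∀ v b, lab (ev v b) = v := fun v b => (ev_eq_iff.1 (hrep (ev v b))).1.symm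
  have edge : ∀ {x y}, (extensionGraph Γ).Adj x y → F y ≤ F x + (Fintype.card V - 2) ∧
      (F x + (Fintype.card V - 2) ≤ F y →
        (star Γ (lab x))ᶜ.ncard ≤ 1 ∧ 2 ≤ (star Γ (lab y))ᶜ.ncard) := by
    intro x y h
    obtain ⟨v, b, rfl⟩ := exists_ev x
    obtain ⟨w, c, rfl⟩ := exists_ev y
    obtain ⟨h1, d, h2, h3⟩ := exists_of_ev_adj h
    rw [ev_congr h2, ev_congr h3, hF, hF, hlab, hlab]
    exact maxOff_le hT hconn (hφ d) h1
  have walk : ∀ {x y} (p : (extensionGraph Γ).Walk x y),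
      F y ≤ F x + (Fintype.card V - 2) * p.length := by
    intro x y p
    induction p with
    | nil => simp
    | cons h p ih =>
      have := (edge h).1
      rw [SimpleGraph.Walk.length_cons]
      push_cast
      linarith
  -- Equality on two consecutive edges would require the complement valence of the middle vertex to
  -- be both at least 2 and at most 1.
  have walk' : ∀ {x y} (p : (extensionGraph Γ).Walk x y), 2 ≤ p.length →
      F y < F x + (Fintype.card V - 2) * p.length := by
    intro x y p hp
    match p, hp with
    | .cons h (.cons h' r), _ =>
      have h1 := edge h
      have h2 := edge h'
      have h3 := walk r
      simp only [SimpleGraph.Walk.length_cons]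
      push_cast
      by_contra hc
      have h4 := h1.2 (by linarith)
      have h5 := h2.2 (by linarith)
      omega
  obtain ⟨p, hp⟩ := (extensionGraph_connected hΓ).exists_walk_length_eq_dist (ev v a)
    (ev v (g ^ m * a))
  have hshift : F (ev v (g ^ m * a)) = F (ev v a) + m := by
    rw [hF, hF]
    refine maxOff_add hT (fun t ht => ?_) v
    simp only [φ]
    rw [idx_zpow_mul (hU t ht) (hgU t ht)]
    ring
  change m < _ * (((extensionGraph Γ).dist _ _ : ℕ) : ℤ)
  rw [← hp]
  have h1 := walk p
  by_cases hl : 2 ≤ p.length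
  · have := walk' p hl
    linarith
  · have hl' : p.length = 0 ∨ p.length = 1 := by omega
    rcases hl' with h0 | h0
    · rw [h0, hshift] at h1
      push_cast at h1
      linarith
    · have h2 := SimpleGraph.dist_eq_one_iff_adj.1 (hp.symm.trans h0)
      exact absurd rfl (exists_of_ev_adj h2).1.ne

/-! ### Quasi-stabilizers -/

/-- The elements moving each of two vertices of the extension graph by at most `ρ`, in terms of
the left action. -/
def quasiStab (v w : V) (p q : Raag Γ) (ρ : ℕ) : Set (Raag Γ) :=
  {g | ed (ev v p) (ev v (g * p)) ≤ ρ ∧ ed (ev w q) (ev w (g * q)) ≤ ρ}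

theorem one_mem_quasiStab (v w : V) (p q : Raag Γ) (ρ : ℕ) : 1 ∈ quasiStab v w p q ρ := by
  simp [quasiStab]

theorem inv_mem_quasiStab (hΓ : Γ.Connected) {v w : V} {p q : Raag Γ} {ρ : ℕ} {g : Raag Γ}
    (h : g ∈ quasiStab v w p q ρ) : g⁻¹ ∈ quasiStab v w p q ρ := by
  have key : ∀ v p, ed (ev v p) (ev v (g⁻¹ * p)) = ed (ev v p) (ev v (g * p)) := by
    intro v p
    rw [← ed_ev_mul hΓ v v g, mul_inv_cancel_left, ed_comm]
  exact ⟨(key v p).le.trans h.1, (key w q).le.trans h.2⟩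

theorem mul_mem_quasiStab (hΓ : Γ.Connected) {v w : V} {p q : Raag Γ} {ρ σ : ℕ} {g h : Raag Γ}
    (hg : g ∈ quasiStab v w p q ρ) (hh : h ∈ quasiStab v w p q σ) :
    g * h ∈ quasiStab v w p q (ρ + σ) := by
  have key : ∀ v p, ed (ev v p) (ev v (g * h * p)) ≤
      ed (ev v p) (ev v (g * p)) + ed (ev v p) (ev v (h * p)) := by
    intro v p
    have := ed_triangle hΓ (ev v p) (ev v (g * p)) (ev v (g * h * p))
    rw [mul_assoc g h p, ed_ev_mul hΓ] at this
    rwa [mul_assoc g h p]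
  exact ⟨(key v p).trans (add_le_add hg.1 hh.1), (key w q).trans (add_le_add hg.2 hh.2)⟩

theorem FarPair.reachable (hΓ : Γ.Connected) {E : Set (Raag Γ)} (hE : 1 ∈ E) {p q : Raag Γ}
    (hM : FarPair (Window E p q)) : ∀ s ∈ labels (Window E p q), ∀ t ∈ labels (Window E p q),
      (offGraph Γ (labels (Window E p q))).Reachable s t := by
  intro s hs t ht
  refine hM.labels_subset hΓ hE (S := {t | (offGraph Γ (labels (Window E p q))).Reachable s t})
    ⟨s, hs, SimpleGraph.Reachable.refl s⟩ (fun a ha haT b hbT hab hadj => ?_) ht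
  have : (offGraph Γ (labels (Window E p q))).Adj a b := ⟨haT, hbT, hab, hadj⟩
  exact SimpleGraph.Reachable.trans ha this.reachable

/-- The translates of two points at the same position along one axis are close. -/
theorem exists_zpow_ed_le [Finite V] (hΓ : Γ.Connected) {v w t : V} {p q h : Raag Γ} {ρ : ℕ}
    (hh : h ∈ quasiStab v w p q ρ) (h1 : h ≠ 1) {W : Set (Raag Γ)} (ht : HasLabel t W)
    (hW : h • W ⊂ W) : ∃ i : ℤ, ed (ev v p) (ev w (h ^ i * q)) ≤ 2 * ρ + 2 * Γ.diam + 4 := by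
  refine ⟨idx h W p - idx h W q, ?_⟩
  set i := idx h W p - idx h W q
  by_contra hc
  set q' := h ^ i * q with hq'
  -- The exponent `i` puts `q'` and `p` at the same position along the axis of `W`.
  have hidx : idx h W q' = idx h W p := by rw [hq', idx_zpow_mul ht hW]; omega
  have hinv := inv_mem_quasiStab hΓ hh
  have hE : (1 : Raag Γ) ∈ ({1, h, h⁻¹} : Set (Raag Γ)) := by simp
  have comm : ∀ e, Commute h e → ed (ev w q') (ev w (e * q')) = ed (ev w q) (ev w (e * q)) := by
    intro e he
    rw [hq', ← mul_assoc, ← (he.zpow_left i).eq, mul_assoc, ed_ev_mul hΓ]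
  have hfar : FarPair (Window {1, h, h⁻¹} p q') := by
    refine farPair_window hΓ (v := v) (w := w) (ρ := ρ) ?_ ?_ (not_le.1 hc)
    · rintro e (rfl | rfl | rfl)
      · simp
      · exact hh.1
      · exact hinv.1
    · rintro e (rfl | rfl | rfl)
      · simp
      · rw [comm e (Commute.refl e)]; exact hh.2
      · rw [comm _ (Commute.refl h).inv_right]; exact hinv.2
  obtain ⟨u, ⟨U, hU, hu⟩, hut⟩ := hfar.exists_label_notMem_star hΓ hE t
  have htu : ¬ Γ.Adj t u := fun h => hut (Or.inr h)
  have hcmp : ∀ K ∈ Window {1, h, h⁻¹} p q', h • K ⊆ K ∨ K ⊆ h • K := fun K hK =>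
    Window.comparable hE (by simp) hK
  have hne : h • U ≠ U := fun h' => h1 (hfar.eq_one hΓ hE hcmp hU h')
  have u1 := hU.2 h (by simp)
  have u2 := hU.2 h⁻¹ (by simp)
  -- Along the axis of `U`, or of its complement, the window forces positions at most `-2` and at
  -- least `1` for the two points. Interleaving with the axis of `W`, where the positions agree,
  -- allows a difference of only 1.
  rcases hcmp U hU with h2 | h2
  · have hs : h • U ⊂ U := Set.ssubset_iff_subset_ne.2 ⟨h2, hne⟩
    obtain ⟨k, hk⟩ := exists_idx_sub ht hu hW hs htu
    have a1 := hk p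
    have a2 := hk q'
    have a3 := (mem_zpow_smul_iff hu hs q' 1).1 (by
      rw [zpow_one, Set.mem_smul_set_iff_inv_smul_mem]; exact u2.2)
    have a4 : ¬ (-1 ≤ idx h U p) := fun h' => u1.1 (by
      have := (mem_zpow_smul_iff hu hs p (-1)).2 h'
      rwa [zpow_neg_one, Set.mem_smul_set_iff_inv_smul_mem, inv_inv] at this)
    omega
  · have hs : h • Uᶜ ⊂ Uᶜ := by
      rw [Set.smul_set_compl]
      exact compl_lt_compl_iff_lt.2 (Set.ssubset_iff_subset_ne.2 ⟨h2, hne.symm⟩)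
    obtain ⟨k, hk⟩ := exists_idx_sub ht hu.compl hW hs htu
    have a1 := hk p
    have a2 := hk q'
    have a3 := (mem_zpow_smul_iff hu.compl hs p 1).1 (by
      rw [zpow_one, Set.mem_smul_set_iff_inv_smul_mem]; exact u2.1)
    have a4 : ¬ (-1 ≤ idx h Uᶜ q') := fun h' => by
      have := (mem_zpow_smul_iff hu.compl hs q' (-1)).2 h'
      rw [zpow_neg_one, Set.mem_smul_set_iff_inv_smul_mem, inv_inv] at this
      exact this u1.2
    omega

/-- The quasi-stabilizer of two distant points lies in a cyclic group, with explicit bounds. -/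
theorem exists_cyclic_of_far [Fintype V] (hΓ : Γ.Connected) {v w : V} {p q : Raag Γ} {ρ : ℕ}
    (hd : 8 * ρ + 2 * Γ.diam + 4 < ed (ev v p) (ev w q)) {h : Raag Γ}
    (hh : h ∈ quasiStab v w p q ρ) (h1 : h ≠ 1) :
    ∃ g : Raag Γ, (∀ v a, ∀ m : ℤ, 0 < m →
        m < (Fintype.card V - 2) * (ed (ev v a) (ev v (g ^ m * a)) : ℤ)) ∧
      (∀ z ∈ quasiStab v w p q ρ, ∃ m : ℤ, z = g ^ m) ∧
      ∃ i : ℤ, ed (ev v p) (ev w (g ^ i * q)) ≤ 2 * ρ + 2 * Γ.diam + 4 := by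
  -- The factor 4 makes room for products of four elements, as the commutator argument requires.
  set E := quasiStab v w p q (4 * ρ) with hEdef
  have hE : (1 : Raag Γ) ∈ E := one_mem_quasiStab v w p q _
  have hM : FarPair (Window E p q) := farPair_window hΓ (v := v) (w := w) (ρ := 4 * ρ)
    (fun e he => he.1) (fun e he => he.2) (by omega)
  have hcomm : ∀ a ∈ quasiStab v w p q ρ, ∀ b ∈ quasiStab v w p q ρ, Commute a b := by
    intro a ha b hb
    refine commute_of_window hΓ hM (one_mem_quasiStab v w p q ρ)
      (fun a ha => inv_mem_quasiStab hΓ ha) (fun a ha b hb c hc d hd => ?_) ha hb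
    have := mul_mem_quasiStab hΓ (mul_mem_quasiStab hΓ (mul_mem_quasiStab hΓ ha hb) hc) hd
    rwa [show ρ + ρ + ρ + ρ = 4 * ρ by ring] at this
  have hsub : quasiStab v w p q ρ ⊆ E := fun a ha =>
    ⟨ha.1.trans (by omega), ha.2.trans (by omega)⟩
  obtain ⟨W, hW⟩ : ∃ W, W ∈ Window E p q := by
    obtain ⟨U, hU, -⟩ := hM; exact ⟨U, hU⟩
  have hcmp : ∀ a ∈ quasiStab v w p q ρ, ∀ K ∈ Window E p q, a • K ⊆ K ∨ K ⊆ a • K :=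
    fun a ha K hK => Window.comparable hE (hsub (inv_mem_quasiStab hΓ ha)) hK
  obtain ⟨h, hh, h1, hhW⟩ : ∃ h ∈ quasiStab v w p q ρ, h ≠ 1 ∧ h • W ⊂ W := by
    have hne : h • W ≠ W := fun h' => h1 (hM.eq_one hΓ hE (hcmp h hh) hW h')
    rcases hcmp h hh W hW with h2 | h2
    · exact ⟨h, hh, h1, Set.ssubset_iff_subset_ne.2 ⟨h2, hne⟩⟩
    · refine ⟨h⁻¹, inv_mem_quasiStab hΓ hh, inv_ne_one.2 h1, ?_⟩
      have := smul_ssubset_smul_iff (a := h⁻¹).2 (Set.ssubset_iff_subset_ne.2 ⟨h2, hne.symm⟩)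
      rwa [inv_smul_smul] at this
  obtain ⟨g, -, hgM, hgen⟩ := exists_generator hΓ hE hM
    (hM.smul_ssubset hΓ hE (hcmp h hh) hW hhW)
  refine ⟨g, fun v a m hm => ?_, fun z hz => hgen z (hcomm h hh z hz), ?_⟩
  · choose! U hU using fun t (ht : t ∈ labels (Window E p q)) => ht
    exact lt_card_mul_ed hΓ (hM.exists_label_notMem_star hΓ hE) (hM.reachable hΓ hE)
      (fun t ht => (hU t ht).2) (fun t ht => hgM _ (hU t ht).1) v a hm
  · obtain ⟨t, ht⟩ := hW.1
    obtain ⟨i, hi⟩ := exists_zpow_ed_le hΓ hh h1 ht hhW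
    obtain ⟨m, hm⟩ := hgen h (Commute.refl h)
    exact ⟨m * i, by rwa [zpow_mul, ← hm]⟩

theorem ev_smul (v : V) (g p : Raag Γ) : ev v p <• g = ev v (g⁻¹ * p) := by
  rw [ev_mul, inv_inv]

section Metric

variable [hΓ : Fact Γ.Connected]

theorem dist_eq_ed (x y : ExtensionVertex Γ) : dist x y = (ed x y : ℝ) := rfl

/-- Distances are integers, so `r` may be rounded down; the right action of `g` is left
multiplication by `g⁻¹`, which has the same displacement. -/
theorem mem_quasiStabilizer_iff {v w : V} {p q g : Raag Γ} {r : ℝ} (hr : 0 ≤ r) :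
    g ∈ quasiStabilizer (ev v p) (ev w q) r ↔ g ∈ quasiStab v w p q ⌊r⌋₊ := by
  have key : ∀ v p, dist (ev v p <• g) (ev v p) ≤ r ↔ ed (ev v p) (ev v (g * p)) ≤ ⌊r⌋₊ := by
    intro v p
    rw [dist_eq_ed, Nat.le_floor_iff hr, ev_smul, ← ed_ev_mul hΓ.out v v g, mul_inv_cancel_left]
  exact and_congr (key v p) (key w q)

theorem isLoxodromic_of_lt [Fintype V] (hcard : 2 < Fintype.card V) {g : Raag Γ}
    (hg : ∀ v a, ∀ m : ℤ, 0 < m →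
      m < (Fintype.card V - 2) * (ed (ev v a) (ev v (g ^ m * a)) : ℤ)) :
    IsLoxodromic (ExtensionVertex Γ) g := by
  obtain ⟨v⟩ := hΓ.out.nonempty
  have hc : (0 : ℝ) < (Fintype.card V : ℝ) - 2 := by
    have : (2 : ℝ) < Fintype.card V := by exact_mod_cast hcard
    linarith
  refine isLoxodromic_of_le (x₀ := ev v 1) (inv_pos.2 hc) fun n => ?_
  rcases Nat.eq_zero_or_pos n with rfl | hn
  · simp
  have h1 := hg v (g ^ (-(n : ℤ))) n (by exact_mod_cast hn)
  rw [← zpow_add, add_neg_cancel, zpow_zero, ed_comm] at h1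
  have h2 : dist (ev v (1 : Raag Γ) <• g ^ n) (ev v 1) =
      (ed (ev v 1) (ev v (g ^ (-(n : ℤ)))) : ℝ) := by
    rw [ev_smul, mul_one, dist_comm, dist_eq_ed, zpow_neg, zpow_natCast]
  have h3 : (n : ℝ) < ((Fintype.card V : ℝ) - 2) * (ed (ev v 1) (ev v (g ^ (-(n : ℤ)))) : ℝ) := by
    exact_mod_cast h1
  rw [h2, inv_mul_le_iff₀ hc]
  exact h3.le

theorem hausdorffEDist_cyclicOrbit_le {v w : V} {p q g : Raag Γ} {i : ℤ} {C : ℝ}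
    (h : (ed (ev v p) (ev w (g ^ i * q)) : ℝ) ≤ C) :
    Metric.hausdorffEDist (cyclicOrbit g (ev v p)) (cyclicOrbit g (ev w q)) ≤ ENNReal.ofReal C := by
  -- The two points are the translates by `g ^ (-m)` of the pair in `h`, so the orbits are matched
  -- with index shift `i`.
  have key : ∀ m : ℤ, edist (ev v p <• g ^ m) (ev w q <• g ^ (m - i)) ≤ ENNReal.ofReal C := by
    intro m
    rw [edist_dist]
    refine ENNReal.ofReal_le_ofReal (le_trans (le_of_eq ?_) h)
    rw [dist_eq_ed, ev_smul, ev_smul, ← ed_ev_mul hΓ.out v w (g ^ (-m)) p, ← mul_assoc,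
      ← zpow_add, ← zpow_neg, ← zpow_neg]
    congr 5
    ring_nf
  refine Metric.hausdorffEDist_le_of_mem_edist ?_ ?_
  · rintro _ ⟨m, rfl⟩
    exact ⟨_, ⟨m - i, rfl⟩, key m⟩
  · rintro _ ⟨m, rfl⟩
    refine ⟨_, ⟨m + i, rfl⟩, ?_⟩
    have := key (m + i)
    rw [edist_comm]
    rwa [add_sub_cancel_right] at this

theorem one_le_diam [Finite V] [Nontrivial V] : 1 ≤ Γ.diam := by
  obtain ⟨v, w, hvw⟩ := exists_pair_ne V
  have := hΓ.out.nonempty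
  exact (hΓ.out.pos_dist_of_ne hvw).trans_le
    (SimpleGraph.dist_le_diam (SimpleGraph.connected_iff_ediam_ne_top.1 hΓ.out))

end Metric

end Raag

/-! ### The theorem -/

open Raag in
theorem quasiStabilizer_subset_zpow {V : Type*} [Fintype V] {Γ : SimpleGraph V}
    [hΓ : Fact Γ.Connected] (hcard : 4 ≤ Fintype.card V) {r : ℝ} (hr : 0 < r)
    {x y : ExtensionVertex Γ}
    (hxy : (Γ.diam : ℝ) * (2 * Fintype.card V + 7) * (r + 1) + 10 * Γ.diam ≤ dist x y)
    (hne : (quasiStabilizer x y r : Set (Raag Γ)) ≠ {1}) :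
    ∃ g : Raag Γ, IsLoxodromic (ExtensionVertex Γ) g ∧
      (∃ k : ℕ, 1 ≤ k ∧ (k : ℝ) ≤ (Fintype.card V - 2) * r - 1 ∧
        (quasiStabilizer x y r : Set (Raag Γ)) ⊆ {h | ∃ m : ℤ, |m| ≤ k ∧ h = g ^ m}) ∧
      Metric.hausdorffEDist (cyclicOrbit g x) (cyclicOrbit g y) ≤
        ENNReal.ofReal (Γ.diam * (2 * r + 7)) := by
  obtain ⟨v, p, rfl⟩ := exists_ev x
  obtain ⟨w, q, rfl⟩ := exists_ev y
  have hnt : Nontrivial V := Fintype.one_lt_card_iff_nontrivial.1 (by omega)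
  have hD : (1 : ℝ) ≤ Γ.diam := by exact_mod_cast one_le_diam (Γ := Γ)
  have hn : (4 : ℝ) ≤ Fintype.card V := by exact_mod_cast hcard
  set ρ := ⌊r⌋₊ with hρ
  have hρr : (ρ : ℝ) ≤ r := Nat.floor_le hr.le
  have hset : quasiStabilizer (ev v p) (ev w q) r = quasiStab v w p q ρ :=
    Set.ext fun g => mem_quasiStabilizer_iff hr.le
  rw [hset] at hne ⊢
  have hd : 8 * ρ + 2 * Γ.diam + 4 < ed (ev v p) (ev w q) := by
    have h1 : (15 : ℝ) ≤ Γ.diam * (2 * Fintype.card V + 7) := by nlinarith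
    have h2 : 15 * (r + 1) ≤ Γ.diam * (2 * Fintype.card V + 7) * (r + 1) :=
      mul_le_mul_of_nonneg_right h1 (by linarith)
    have h3 : (8 * ρ + 2 * Γ.diam + 4 : ℝ) < (ed (ev v p) (ev w q) : ℝ) := by
      rw [dist_eq_ed] at hxy
      linarith
    exact_mod_cast h3
  obtain ⟨h, hh, h1⟩ : ∃ h ∈ quasiStab v w p q ρ, h ≠ 1 := by
    by_contra hc
    push Not at hc
    exact hne (Set.eq_singleton_iff_unique_mem.2 ⟨one_mem_quasiStab v w p q ρ, hc⟩)
  obtain ⟨g, hg, hcyc, i, hi⟩ := exists_cyclic_of_far hΓ.out hd hh h1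
  have bound : ∀ m : ℤ, m ≠ 0 → g ^ m ∈ quasiStab v w p q ρ →
      |m| + 1 ≤ ((Fintype.card V - 2) * ρ : ℤ) := by
    have pos : ∀ m : ℤ, 0 < m → g ^ m ∈ quasiStab v w p q ρ →
        m + 1 ≤ ((Fintype.card V - 2) * ρ : ℤ) := by
      intro m hm hmem
      have h2 := hg v p m hm
      have h3 : ((ed (ev v p) (ev v (g ^ m * p)) : ℕ) : ℤ) ≤ ρ := by exact_mod_cast hmem.1
      have h4 : (0 : ℤ) ≤ Fintype.card V - 2 := by omega
      have := mul_le_mul_of_nonneg_left h3 h4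
      omega
    intro m hm hmem
    rcases lt_or_gt_of_ne hm with h2 | h2
    · rw [abs_of_neg h2]
      exact pos (-m) (by omega) (by rw [zpow_neg]; exact inv_mem_quasiStab hΓ.out hmem)
    · rw [abs_of_pos h2]
      exact pos m h2 hmem
  obtain ⟨m₀, rfl⟩ := hcyc h hh
  have hm₀ : m₀ ≠ 0 := by rintro rfl; exact h1 (zpow_zero g)
  have hb₀ := bound m₀ hm₀ hh
  have hpos₀ := abs_pos.2 hm₀
  -- The displacement bound is strict, whence the `- 1`; the nontrivial element `g ^ m₀` ensures `1
  -- ≤ k`.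
  obtain ⟨k, hk⟩ := Int.eq_ofNat_of_zero_le (a := ((Fintype.card V - 2) * ρ : ℤ) - 1) (by omega)
  refine ⟨g, isLoxodromic_of_lt (by omega) hg, ⟨k, by omega, ?_, fun z hz => ?_⟩, ?_⟩
  · have h2 : (k : ℝ) = ((Fintype.card V : ℝ) - 2) * ρ - 1 := by exact_mod_cast hk.symm
    rw [h2]
    have := mul_le_mul_of_nonneg_left hρr (show (0 : ℝ) ≤ (Fintype.card V : ℝ) - 2 by linarith)
    linarith
  · obtain ⟨m, rfl⟩ := hcyc z hz
    refine ⟨m, ?_, rfl⟩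
    by_cases hm : m = 0
    · rw [hm, abs_zero]; positivity
    · have := bound m hm hz
      omega
  · refine hausdorffEDist_cyclicOrbit_le (i := i) (le_trans (b := (2 * ρ + 2 * Γ.diam + 4 : ℝ)) ?_ ?_)
    · exact_mod_cast hi
    -- Uses `1 ≤ Γ.diam`: then `2 * r + 2 * D + 4 ≤ D * (2 * r + 7)` with `D = Γ.diam`.
    · nlinarith

theorem theoremA {V : Type*} [Fintype V] (Γ : SimpleGraph V) [Fact Γ.Connected]
    (hcompl : Γᶜ.Connected) (hcard : 4 ≤ Fintype.card V)
    (n D : ℝ) (hn : n = Fintype.card V) (hD : D = Γ.diam)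
    (R N : ℝ → ℝ) (hR : ∀ r, R r = D * (2 * n + 7) * (r + 1) + 10 * D)
    (hN : ∀ r, N r = max 1 (2 * (n - 2) * r - 1)) :
    IsAcylindricalWith (Raag Γ) (ExtensionVertex Γ) R N ∧
    ∀ (r : ℝ), 0 < r → ∀ x y : ExtensionVertex Γ, R r ≤ dist x y →
      (quasiStabilizer x y r : Set (Raag Γ)) ≠ {1} →
      ∃ g : Raag Γ, IsLoxodromic (ExtensionVertex Γ) g ∧
        (∃ k : ℕ, 1 ≤ k ∧ (k : ℝ) ≤ (n - 2) * r - 1 ∧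
          (quasiStabilizer x y r : Set (Raag Γ)) ⊆ {h | ∃ m : ℤ, |m| ≤ k ∧ h = g ^ m}) ∧
        Metric.hausdorffEDist (cyclicOrbit g x) (cyclicOrbit g y) ≤
          ENNReal.ofReal (D * (2 * r + 7)) := by
  subst hn hD
  have main : ∀ (r : ℝ), 0 < r → ∀ x y : ExtensionVertex Γ, R r ≤ dist x y →
      (quasiStabilizer x y r : Set (Raag Γ)) ≠ {1} → _ := fun r hr x y hxy =>
    quasiStabilizer_subset_zpow hcard hr (hR r ▸ hxy)
  refine ⟨fun r hr => ⟨?_, ?_, fun x y hxy => ?_⟩, main⟩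
  · have hnt : Nontrivial V := Fintype.one_lt_card_iff_nontrivial.1 (by omega)
    have hD : (1 : ℝ) ≤ Γ.diam := by exact_mod_cast Raag.one_le_diam (Γ := Γ)
    rw [hR]
    positivity
  · rw [hN]
    exact lt_of_lt_of_le one_pos (le_max_left _ _)
  · rw [hN]
    by_cases hne : (quasiStabilizer x y r : Set (Raag Γ)) = {1}
    · rw [hne]
      exact ⟨Set.finite_singleton 1, by rw [Set.ncard_singleton, Nat.cast_one]; exact le_max_left _ _⟩
    · obtain ⟨g, -, ⟨k, -, hk, hsub⟩, -⟩ := main r hr x y hxy hne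
      have hsub' : (quasiStabilizer x y r : Set (Raag Γ)) ⊆
          (fun m : ℤ => g ^ m) '' (Finset.Icc (-k : ℤ) k : Set ℤ) := by
        intro h hh
        obtain ⟨m, hm, rfl⟩ := hsub hh
        exact ⟨m, by simpa [abs_le] using hm, rfl⟩
      have hfin : ((fun m : ℤ => g ^ m) '' (Finset.Icc (-k : ℤ) k : Set ℤ)).Finite :=
        (Finset.finite_toSet _).image _
      refine ⟨hfin.subset hsub', le_trans ?_ (le_max_right _ _)⟩
      -- There are `2 * k + 1` exponents from `-k` to `k`, and `k ≤ (|V| - 2) * r - 1` turns this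
      -- into `2 * (|V| - 2) * r - 1`.
      have h1 : (quasiStabilizer x y r : Set (Raag Γ)).ncard ≤ 2 * k + 1 := by
        refine (Set.ncard_le_ncard hsub' hfin).trans ((Set.ncard_image_le (Finset.finite_toSet _)).trans ?_)
        rw [Set.ncard_coe_finset, Int.card_Icc]
        omega
      have h2 : ((quasiStabilizer x y r : Set (Raag Γ)).ncard : ℝ) ≤ 2 * k + 1 := by
        exact_mod_cast h1
      linarith
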